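/- **Theorem.** Let $q\in(2,\infty)$. Throughout, $|\cdot|$ is the Euclidean norm and $\operatorname{diam}$ the Euclidean diameter. (a) Let $\mathbb S$ be the unit sphere of $\mathbb R^3$ with its surface measure, and let $\Phi\colon\mathbb R^3\to\mathbb R^3$ be a bi-Lipschitz map of $\mathbb R^3$ onto itself that takes the cube $[0,1]^3$ onto the closed unit ball. For $k\ge 1$ let $\tilde{\mathcal D}_k$ be the collection of the sets $\Phi(Q)\subset\mathbb S$, where $Q$ runs through the $6\cdot 2^{2k}$ closed squares of side length $2^{-k}$ that are obtained by dividing each of the six faces of $[0,1]^3$ into $2^{2k}$ equal dyadic squares. Then a homeomorphism $\varphi$ of $\mathbb S$ onto $\mathbb S$ satisfies $$\int_{\mathbb S}\int_{\mathbb S}\frac{|\varphi(x)-\varphi(y)|^q}{|x-y|^{q+1}}\,dx\,dy<\infty$$ (that is, its Gagliardo $W^{1-1/q,q}$ seminorm is finite) if and only if $$\sum_{k=1}^\infty 2^{k(q-3)}\sum_{\tilde Q\in\tilde{\mathcal D}_k}\big[\operatorname{diam}\varphi(\tilde Q)\big]^q<\infty .$$ (b) Let $\varphi$ be a homeomorphism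 of $\mathbb R^2$ onto $\mathbb R^2$. For $R>0$ let $\mathbb I_R=[-R,R]^2$, and for integers $N,k\ge 1$ let $\tilde{\mathcal D}^N_k$ be the collection of the $2^{2k}$ closed dyadic squares of side length $2N\cdot 2^{-k}$ into which $\mathbb I_N$ is divided. Then $$\int_{\mathbb I_R}\int_{\mathbb I_R}\frac{|\varphi(x)-\varphi(y)|^q}{|x-y|^{q+1}}\,dx\,dy<\infty\quad\text{for every }R>0$$ if and only if $$\sum_{k=1}^\infty 2^{k(q-3)}\sum_{\tilde Q\in\tilde{\mathcal D}^N_k}\big[\operatorname{diam}\varphi(\tilde Q)\big]^q<\infty\quad\text{for every integer }N\ge 1 .$$ -/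

import Mathlib

open MeasureTheory Set
open scoped ENNReal

/-- The Gagliardo double integral
`∫ ∫ |φ x - φ y| ^ q / |x - y| ^ (q + 1) dμ(x) dμ(y)`
over a two-dimensional domain with measure `μ`; it is the `q`-th power of the
`W^{1 - 1/q, q}` seminorm, since `q + 1 = 2 + (1 - 1/q) q`.
The integrand is nonnegative and the integral takes values in `[0, ∞]`. -/
noncomputable def gagliardoEnergy {X Y : Type*} [MetricSpace X] [MeasurableSpace X]
    [MetricSpace Y] (μ : Measure X) (q : ℝ) (φ : X → Y) : ℝ≥0∞ :=
  ∫⁻ x, ∫⁻ y, ENNReal.ofReal (dist (φ x) (φ y) ^ q / dist x y ^ (q + 1)) ∂μ ∂μ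

/-- The sum `∑_{k ≥ 1} 2 ^ (k (q - 3)) ∑_j (diam φ(Q k j)) ^ q`, with values in `[0, ∞]`,
for a sequence of finite families `Q k` of sets. -/
noncomputable def diameterSum {X Y : Type*} [MetricSpace Y] {ι : ℕ → Type}
    [∀ k, Fintype (ι k)] (Q : ∀ k, ι k → Set X) (q : ℝ) (φ : X → Y) : ℝ≥0∞ :=
  ∑' k : {k : ℕ // 1 ≤ k}, (2 : ℝ≥0∞) ^ ((k.1 : ℝ) * (q - 3)) *
    ∑ j : ι k.1, Metric.ediam (φ '' Q k.1 j) ^ q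

/-- The square `[-R, R]²`. -/
def planeSquare (R : ℝ) : Set (EuclideanSpace ℝ (Fin 2)) :=
  {x | ∀ i, x i ∈ Icc (-R) R}

/-- The closed dyadic squares of generation `k` of `[-R, R]²`; the square with index `m`
is the product of the intervals `[-R + 2R m_i / 2^k, -R + 2R (m_i + 1) / 2^k]`. -/
def planeDyadicSquare (R : ℝ) (k : ℕ) (m : Fin 2 → Fin (2 ^ k)) :
    Set (EuclideanSpace ℝ (Fin 2)) :=
  {x | ∀ i, x i ∈ Icc (-R + 2 * R * (((m i : ℕ) : ℝ) / 2 ^ k))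
    (-R + 2 * R * ((((m i : ℕ) : ℝ) + 1) / 2 ^ k))}

/-- The unit cube `[0, 1]³`. -/
def unitCube : Set (EuclideanSpace ℝ (Fin 3)) :=
  {x | ∀ i, x i ∈ Icc (0 : ℝ) 1}

/-- The closed dyadic squares of generation `k` of the boundary of the unit cube.
The index `(i, s, m)` stands for the square with index `m` in the face `x i = s`,
where `s` is `0` or `1`. -/
def cubeDyadicSquare (k : ℕ) (j : Fin 3 × Fin 2 × (Fin 2 → Fin (2 ^ k))) :
    Set (EuclideanSpace ℝ (Fin 3)) :=
  {x | x j.1 = ((j.2.1 : ℕ) : ℝ) ∧ ∀ l : Fin 2, x (j.1.succAbove l) ∈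
    Icc (((j.2.2 l : ℕ) : ℝ) / 2 ^ k) ((((j.2.2 l : ℕ) : ℝ) + 1) / 2 ^ k)}

/-- The unit sphere of three-dimensional Euclidean space. -/
abbrev UnitSphere : Type :=
  Metric.sphere (0 : EuclideanSpace ℝ (Fin 3)) 1

/-- `Φ` is a bi-Lipschitz map of the metric space `X` onto `Y`: a bijection with
`c |x - y| ≤ |Φ x - Φ y| ≤ C |x - y|` for some constants `c, C > 0`. -/
def IsBiLipschitz {X Y : Type*} [MetricSpace X] [MetricSpace Y] (Φ : X → Y) : Prop :=
  Function.Bijective Φ ∧ ∃ c C : ℝ, 0 < c ∧ 0 < C ∧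
    ∀ x y, c * dist x y ≤ dist (Φ x) (Φ y) ∧ dist (Φ x) (Φ y) ≤ C * dist x y

/-- The members `Φ(Q)` of the `k`-th generation dyadic decomposition of the sphere that
is induced by `Φ`, where `Q` runs through the `k`-th generation dyadic squares of the
boundary of the unit cube, as subsets of the sphere. -/
def sphereDyadicSquare (Φ : EuclideanSpace ℝ (Fin 3) → EuclideanSpace ℝ (Fin 3)) (k : ℕ)
    (j : Fin 3 × Fin 2 × (Fin 2 → Fin (2 ^ k))) : Set UnitSphere :=
  Subtype.val ⁻¹' (Φ '' cubeDyadicSquare k j)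

/-!
Both parts are instances of one metric statement: a space whose balls have measure comparable to
the square of their radius, decomposed into sets of diameter comparable to `2⁻ᵏ` with bounded
overlap. A bi-Lipschitz atlas transports this structure from the unit square to the plane square
and to the sphere.

If the diameter sum is finite, two points at distance about `2⁻ⁱ` are joined by a connected set
covered by boundedly many squares of every later generation, so `|φ x - φ y|` is bounded by a sum
of diameters; integrating the `q`-th power gives the energy. Conversely, `φ` is a homeomorphism, so
the diameter of the image of a small ball is at most that of the image of any larger sphere around
it. On such a sphere `φ` is controlled by telescoping its means over shrinking balls; averaging over
the radius of the sphere turns this pointwise control into an integral one, and `q > 2` makes the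
resulting series over the scales converge.
-/

section Sums

lemma two_rpow_add (a b : ℝ) : (2 : ℝ≥0∞) ^ (a + b) = 2 ^ a * 2 ^ b :=
  ENNReal.rpow_add _ _ two_ne_zero ENNReal.ofNat_ne_top

lemma two_rpow_neg_mul_two_rpow (a : ℝ) : (2 : ℝ≥0∞) ^ (-a) * 2 ^ a = 1 := by
  rw [← two_rpow_add, neg_add_cancel, ENNReal.rpow_zero]

lemma ofReal_two_inv_pow (k : ℕ) : ENNReal.ofReal (2⁻¹ ^ k) = 2 ^ (-(k : ℝ)) := by
  rw [ENNReal.rpow_neg, ENNReal.rpow_natCast, inv_pow, ENNReal.ofReal_inv_of_pos (by positivity),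
    ENNReal.ofReal_pow zero_le_two, ENNReal.ofReal_ofNat]

lemma ofReal_two_inv_pow_rpow_neg (k : ℕ) (s : ℝ) :
    ENNReal.ofReal ((2⁻¹ ^ k) ^ (-s)) = 2 ^ (k * s) := by
  rw [← ENNReal.ofReal_rpow_of_pos (by positivity), ofReal_two_inv_pow, ← ENNReal.rpow_mul,
    neg_mul_neg]

lemma exists_two_inv_pow_lt_le {d : ℝ} (h0 : 0 < d) (h1 : d ≤ 2⁻¹) :
    ∃ k : ℕ, 1 ≤ k ∧ 2⁻¹ ^ (k + 1) < d ∧ d ≤ 2⁻¹ ^ k := by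
  obtain ⟨n, hn, hn'⟩ := exists_nat_pow_near_of_lt_one (y := (2⁻¹ : ℝ)) h0 (by linarith)
    (by norm_num) (by norm_num)
  refine ⟨n, Nat.one_le_iff_ne_zero.2 ?_, hn, hn'⟩
  rintro rfl
  rw [zero_add, pow_one] at hn
  linarith

lemma tendsto_mul_two_inv_pow (r : ℝ) :
    Filter.Tendsto (fun i : ℕ => r * 2⁻¹ ^ i) Filter.atTop (nhds 0) := by
  simpa using (tendsto_pow_atTop_nhds_zero_of_lt_one (r := (2⁻¹ : ℝ)) (by norm_num)
    (by norm_num)).const_mul r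

lemma inv_ofReal_mul_two_inv_pow {r : ℝ} (hr : 0 < r) (k : ℕ) :
    (ENNReal.ofReal (r * 2⁻¹ ^ k))⁻¹ = (ENNReal.ofReal r)⁻¹ * 2 ^ (k : ℝ) := by
  rw [ENNReal.ofReal_mul hr.le, ofReal_two_inv_pow, ENNReal.mul_inv (.inr (by finiteness))
    (.inl ENNReal.ofReal_ne_top), ENNReal.rpow_neg, inv_inv]

lemma sum_rpow_le_card_rpow_mul_sum {ι : Type*} (s : Finset ι) (f : ι → ℝ≥0∞) {q : ℝ}
    (hq : 0 < q) : (∑ i ∈ s, f i) ^ q ≤ (s.card : ℝ≥0∞) ^ q * ∑ i ∈ s, f i ^ q := by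
  have hle : ∀ i ∈ s, f i ≤ (∑ i ∈ s, f i ^ q) ^ q⁻¹ := fun i hi =>
    (ENNReal.le_rpow_inv_iff hq).2 (Finset.single_le_sum (f := fun i => f i ^ q)
      (fun _ _ => zero_le) hi)
  calc (∑ i ∈ s, f i) ^ q ≤ (s.card • (∑ i ∈ s, f i ^ q) ^ q⁻¹) ^ q :=
        ENNReal.rpow_le_rpow (Finset.sum_le_card_nsmul _ _ _ hle) hq.le
    _ = s.card ^ q * ∑ i ∈ s, f i ^ q := by
        rw [nsmul_eq_mul, ENNReal.mul_rpow_of_nonneg _ _ hq.le, ENNReal.rpow_inv_rpow hq.ne']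

lemma sum_range_pow_le {a : ℝ≥0∞} (ha : 2 ≤ a) (n : ℕ) : ∑ i ∈ Finset.range n, a ^ i ≤ a ^ n := by
  induction n with
  | zero => simp
  | succ n ih =>
    calc ∑ i ∈ Finset.range (n + 1), a ^ i ≤ a ^ n + a ^ n := by
          rw [Finset.sum_range_succ]
          gcongr
      _ ≤ a ^ (n + 1) := by
          rw [← mul_two, pow_succ]
          gcongr

lemma tsum_two_rpow_indicator_le {s d ρ : ℝ} (hs : 1 ≤ s) (hd : 0 < d) (hρ : 0 < ρ) :
    ∑' j : ℕ, {j : ℕ | d ≤ ρ * 2⁻¹ ^ j}.indicator (fun j => (2 : ℝ≥0∞) ^ (j * s)) j ≤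
      2 ^ s * ENNReal.ofReal ((d / ρ) ^ (-s)) := by
  obtain ⟨n, hn, hmin⟩ : ∃ n : ℕ, ρ * 2⁻¹ ^ n < d ∧ ∀ m < n, d ≤ ρ * 2⁻¹ ^ m := by
    classical
    have hex : ∃ n : ℕ, ρ * 2⁻¹ ^ n < d := by
      obtain ⟨n, hn⟩ := exists_pow_lt_of_lt_one (div_pos hd hρ) (show (2⁻¹ : ℝ) < 1 by norm_num)
      exact ⟨n, (lt_div_iff₀' hρ).1 hn⟩
    exact ⟨Nat.find hex, Nat.find_spec hex, fun m hm => not_lt.1 (Nat.find_min hex hm)⟩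
  have hpow (j : ℕ) : (2 : ℝ≥0∞) ^ (j * s) = (2 ^ s) ^ j := by
    rw [← ENNReal.rpow_mul_natCast, mul_comm]
  have htail : ∀ j ∉ Finset.range n, j ∉ {j : ℕ | d ≤ ρ * 2⁻¹ ^ j} := by
    intro j hj hdj
    have hnj : (2⁻¹ : ℝ) ^ j ≤ 2⁻¹ ^ n :=
      pow_le_pow_of_le_one (by norm_num) (by norm_num) (by simpa using hj)
    exact (hdj.trans (mul_le_mul_of_nonneg_left hnj hρ.le)).not_gt hn
  have htwo : (2 : ℝ≥0∞) ≤ 2 ^ s := by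
    simpa using ENNReal.rpow_le_rpow_of_exponent_le one_le_two hs
  calc _ ≤ ∑ j ∈ Finset.range n, ((2 : ℝ≥0∞) ^ s) ^ j := by
        rw [tsum_eq_sum fun j hj => indicator_of_notMem (htail j hj) _]
        exact Finset.sum_le_sum fun j _ => (indicator_le_self _ _ j).trans_eq (hpow j)
    _ ≤ 2 ^ s * ENNReal.ofReal ((d / ρ) ^ (-s)) := by
        obtain _ | m := n
        · simp
        refine (sum_range_pow_le htwo _).trans ?_
        rw [pow_succ', ← hpow, ← ofReal_two_inv_pow_rpow_neg]
        exact mul_le_mul_right (ENNReal.ofReal_le_ofReal (Real.rpow_le_rpow_of_nonpos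
          (by positivity) ((div_le_iff₀' hρ).2 (hmin m m.lt_succ_self)) (by linarith))) _

/-- The sum `1 + 2⁻ˢ + 2⁻²ˢ + ⋯` of the geometric series of ratio `2⁻ˢ`. -/
noncomputable def geometricSum (s : ℝ) : ℝ≥0∞ :=
  ∑' i : ℕ, 2 ^ (-(i * s))

lemma geometricSum_ne_top {s : ℝ} (hs : 0 < s) : geometricSum s ≠ ⊤ := by
  have hpow (i : ℕ) : (2 : ℝ≥0∞) ^ (-(i * s)) = (2 ^ (-s)) ^ i := by
    rw [← ENNReal.rpow_mul_natCast]
    congr 1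
    ring
  rw [geometricSum, tsum_congr hpow, ENNReal.tsum_geometric]
  exact ENNReal.inv_ne_top.2 (tsub_pos_of_lt
    (ENNReal.rpow_lt_one_of_one_lt_of_neg ENNReal.one_lt_two (neg_lt_zero.2 hs))).ne'

lemma tsum_rpow_le_geometricSum (b : ℕ → ℝ≥0∞) {q : ℝ} (hq : 0 < q) (ε : ℝ) :
    (∑' i, b i) ^ q ≤ geometricSum (ε / q) ^ q * ∑' i : ℕ, 2 ^ (i * ε) * b i ^ q := by
  set S := ∑' i : ℕ, 2 ^ (i * ε) * b i ^ q
  have hterm (i : ℕ) : b i ≤ 2 ^ (-(i * (ε / q))) * S ^ q⁻¹ := by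
    have hS : 2 ^ (i * ε) * b i ^ q ≤ S :=
      ENNReal.le_tsum (f := fun i : ℕ => 2 ^ (i * ε) * b i ^ q) i
    calc b i = (2 ^ (-(i * ε)) * (2 ^ (i * ε) * b i ^ q)) ^ q⁻¹ := by
          rw [← mul_assoc, two_rpow_neg_mul_two_rpow, one_mul, ENNReal.rpow_rpow_inv hq.ne']
      _ ≤ (2 ^ (-(i * ε)) * S) ^ q⁻¹ := by gcongr
      _ = 2 ^ (-(i * (ε / q))) * S ^ q⁻¹ := by
          rw [ENNReal.mul_rpow_of_nonneg _ _ (by positivity), ← ENNReal.rpow_mul]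
          congr 2
          ring
  calc (∑' i, b i) ^ q ≤ (geometricSum (ε / q) * S ^ q⁻¹) ^ q := by
        rw [geometricSum, ← ENNReal.tsum_mul_right]
        gcongr
        exact hterm _
    _ = geometricSum (ε / q) ^ q * S := by
        rw [ENNReal.mul_rpow_of_nonneg _ _ hq.le, ENNReal.rpow_inv_rpow hq.ne']

lemma tsum_tsum_mul_add_le (w V : ℕ → ℝ≥0∞) :
    ∑' k, ∑' i, w i * V (k + i) ≤ (∑' i, w i) * ∑' k, V k := by
  rw [ENNReal.tsum_comm, ← ENNReal.tsum_mul_right]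
  gcongr with i
  rw [ENNReal.tsum_mul_left]
  exact mul_le_mul_right (ENNReal.tsum_comp_le_tsum_of_injective (add_left_injective i) V) _

lemma tsum_ne_top_of_eventually_le {f g : ℕ → ℝ≥0∞} (hf : ∀ k, f k ≠ ⊤)
    (hfg : ∀ᶠ k in Filter.atTop, f k ≤ g k) (hg : ∑' k, g k ≠ ⊤) : ∑' k, f k ≠ ⊤ := by
  obtain ⟨n, hn⟩ := Filter.eventually_atTop.1 hfg
  have htail : ∑' k, f (k + n) ≤ ∑' k, g k :=
    (ENNReal.tsum_le_tsum fun k => hn (k + n) (Nat.le_add_left n k)).trans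
      (ENNReal.tsum_comp_le_tsum_of_injective (add_left_injective n) g)
  rw [← ENNReal.summable.sum_add_tsum_nat_add' (f := f) (k := n)]
  exact ENNReal.add_ne_top.2 ⟨ENNReal.sum_ne_top.2 fun k _ => hf k, ne_top_of_le_ne_top hg htail⟩

end Sums

section Kernel

variable {X Y : Type*} [MetricSpace X] [MetricSpace Y] {q : ℝ}

lemma ofReal_dist_rpow_div (hq : 0 < q) (φ : X → Y) (x y : X) :
    ENNReal.ofReal (dist (φ x) (φ y) ^ q / dist x y ^ (q + 1)) =
      edist (φ x) (φ y) ^ q * ENNReal.ofReal (dist x y ^ (-(q + 1))) := by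
  rw [div_eq_mul_inv, ← Real.rpow_neg dist_nonneg, ENNReal.ofReal_mul (by positivity),
    edist_dist, ENNReal.ofReal_rpow_of_nonneg dist_nonneg hq.le]

lemma ofReal_dist_rpow_div_le (hq : 0 < q) (φ : X → Y) {x y : X} {k : ℕ}
    (h : 2⁻¹ ^ k ≤ dist x y) :
    ENNReal.ofReal (dist (φ x) (φ y) ^ q / dist x y ^ (q + 1)) ≤
      edist (φ x) (φ y) ^ q * 2 ^ (k * (q + 1)) := by
  rw [ofReal_dist_rpow_div hq, ← ofReal_two_inv_pow_rpow_neg]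
  exact mul_le_mul_right (ENNReal.ofReal_le_ofReal
    (Real.rpow_le_rpow_of_nonpos (by positivity) h (by linarith))) _

end Kernel

section DyadicCovering

open Metric

variable {X : Type*} [MetricSpace X] {ι : ℕ → Type} {Ω : Set X} {Q : ∀ k, ι k → Set X}

/-- A sequence of coverings of `Ω` by nonempty subsets of `Ω` that share the geometry of the dyadic
squares: the sets of generation `k` have diameter `O(2⁻ᵏ)`, and a ball of radius `O(2⁻ᵏ)` meets
boundedly many of them. -/
structure IsDyadicCovering (Ω : Set X) (Q : ∀ k, ι k → Set X) : Prop where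
  nonempty : ∀ k j, (Q k j).Nonempty
  iUnion_eq : ∀ k, ⋃ j, Q k j = Ω
  exists_dist_le : ∃ D : ℝ, 0 < D ∧ ∀ k j, ∀ x ∈ Q k j, ∀ y ∈ Q k j, dist x y ≤ D * 2⁻¹ ^ k
  exists_ncard_le : ∀ A : ℝ, ∃ M : ℕ, ∀ k x,
    {j | (Q k j ∩ closedBall x (A * 2⁻¹ ^ k)).Nonempty}.ncard ≤ M

lemma IsDyadicCovering.exists_center (hQ : IsDyadicCovering Ω Q) :
    ∃ D : ℝ, 0 < D ∧ ∃ p : ∀ k, ι k → X, ∀ k j, p k j ∈ Q k j ∧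
      Q k j ⊆ closedBall (p k j) (D * 2⁻¹ ^ k) := by
  obtain ⟨D, hD, hdist⟩ := hQ.exists_dist_le
  choose p hp using hQ.nonempty
  exact ⟨D, hD, p, fun k j => ⟨hp k j, fun x hx => hdist k j x hx _ (hp k j)⟩⟩

lemma IsDyadicCovering.comp_equiv {κ : ℕ → Type} (hQ : IsDyadicCovering Ω Q)
    (e : ∀ k, κ k ≃ ι k) : IsDyadicCovering Ω fun k j => Q k (e k j) where
  nonempty k j := hQ.nonempty k (e k j)
  iUnion_eq k := ((e k).surjective.iUnion_comp (Q k)).trans (hQ.iUnion_eq k)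
  exists_dist_le := by
    obtain ⟨D, hD, hdist⟩ := hQ.exists_dist_le
    exact ⟨D, hD, fun k j => hdist k (e k j)⟩
  exists_ncard_le A := by
    obtain ⟨M, hM⟩ := hQ.exists_ncard_le A
    refine ⟨M, fun k x => (hM k x).trans' (Eq.le ?_)⟩
    rw [← Set.ncard_image_of_injective _ (e k).injective]
    congr 1
    exact (e k).image_eq_preimage_symm _ |>.trans (by ext; simp)

end DyadicCovering

section DiameterSumToGagliardo

open Metric

lemma edist_le_sum_ediam_of_isPreconnected {X Y ι : Type*} [TopologicalSpace X] [MetricSpace Y]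
    {s : Finset ι} {F : ι → Set X} {K : Set X} (hK : IsPreconnected K)
    (hcov : K ⊆ ⋃ i ∈ s, F i) {f : X → Y} (hf : Continuous f) {x y : X} (hx : x ∈ K)
    (hy : y ∈ K) : edist (f x) (f y) ≤ ∑ i ∈ s, ediam (f '' F i) := by
  set g : X → ℝ := fun z => dist (f x) (f z)
  have hIcc : Icc (g x) (g y) ⊆ ⋃ i ∈ s, g '' F i := by
    rw [← image_iUnion₂]
    exact ((hK.image g (continuous_const.dist hf).continuousOn).Icc_subset
      (mem_image_of_mem g hx) (mem_image_of_mem g hy)).trans (image_mono hcov)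
  have hdiam (i : ι) : ediam (g '' F i) ≤ ediam (f '' F i) := by
    simpa [g, image_image] using (LipschitzWith.dist_right (f x)).ediam_image_le (f '' F i)
  calc edist (f x) (f y) = volume (Icc (g x) (g y)) := by
        rw [Real.volume_Icc, edist_dist, show g x = 0 from dist_self _, sub_zero]
    _ ≤ ∑ i ∈ s, volume (g '' F i) := (measure_mono hIcc).trans (measure_biUnion_finset_le _ _)
    _ ≤ ∑ i ∈ s, ediam (f '' F i) :=
        Finset.sum_le_sum fun i _ => (Real.volume_le_diam _).trans (hdiam i)

variable {X Y : Type*} [MetricSpace X] [MetricSpace Y] {q : ℝ} {φ : X → Y}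

/-- The part of the diameter sum of one generation `Q` that is seen from the point `x`: only the
sets `Q j` whose center `p j` has distance at most `R` from `x` contribute. -/
noncomputable def nearbyDiameterSum {ι : Type*} [Fintype ι] (Q : ι → Set X) (p : ι → X) (R : ℝ)
    (q : ℝ) (φ : X → Y) (x : X) : ℝ≥0∞ :=
  ∑ j, (closedBall (p j) R).indicator (fun _ => ediam (φ '' Q j) ^ q) x

lemma edist_rpow_le_nearbyDiameterSum {ι : Type*} [Fintype ι] {Q : ι → Set X} {p : ι → X}
    {s r : ℝ} (hQ : ∀ j, Q j ⊆ closedBall (p j) s) (hq : 0 < q) (hφ : Continuous φ) {x y : X}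
    {M : ℕ} (hM : {j | (Q j ∩ closedBall x r).Nonempty}.ncard ≤ M) {K : Set X}
    (hK : IsPreconnected K) (hKQ : K ⊆ ⋃ j, Q j) (hKr : K ⊆ closedBall x r) (hx : x ∈ K)
    (hy : y ∈ K) :
    edist (φ x) (φ y) ^ q ≤ M ^ q * nearbyDiameterSum Q p (s + r) q φ x := by
  classical
  set J : Finset ι := {j | (Q j ∩ closedBall x r).Nonempty}
  have hJcard : J.card ≤ M := by
    rwa [← Set.ncard_coe_finset, Finset.coe_filter_univ]
  have hKJ : K ⊆ ⋃ j ∈ J, Q j := fun z hz => by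
    obtain ⟨j, hj⟩ := mem_iUnion.1 (hKQ hz)
    exact mem_biUnion (Finset.mem_filter_univ j |>.2 ⟨z, hj, hKr hz⟩) hj
  have hnear : ∀ j ∈ J, x ∈ closedBall (p j) (s + r) := fun j hj => by
    obtain ⟨z, hzQ, hzx⟩ := (Finset.mem_filter_univ j).1 hj
    have hzp := mem_closedBall.1 (hQ j hzQ)
    have hxz := mem_closedBall'.1 hzx
    exact mem_closedBall.2 (by linarith [dist_triangle x z (p j)])
  calc edist (φ x) (φ y) ^ q ≤ (∑ j ∈ J, ediam (φ '' Q j)) ^ q := by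
        gcongr
        exact edist_le_sum_ediam_of_isPreconnected hK hKJ hφ hx hy
    _ ≤ J.card ^ q * ∑ j ∈ J, ediam (φ '' Q j) ^ q := sum_rpow_le_card_rpow_mul_sum _ _ hq
    _ = J.card ^ q *
          ∑ j ∈ J, (closedBall (p j) (s + r)).indicator (fun _ => ediam (φ '' Q j) ^ q) x := by
        congr 1
        exact Finset.sum_congr rfl fun j hj => (indicator_of_mem (hnear j hj) fun _ => _).symm
    _ ≤ M ^ q * nearbyDiameterSum Q p (s + r) q φ x := by
        gcongr
        exact Finset.sum_le_sum_of_subset (Finset.subset_univ J)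

lemma ofReal_dist_rpow_div_le_add_tsum {Ω : Set X} (hq : 0 < q) {F : ℕ → X → ℝ≥0∞}
    (hF : ∀ k, 1 ≤ k → ∀ x ∈ Ω, ∀ y ∈ Ω, dist x y ≤ 2⁻¹ ^ k → edist (φ x) (φ y) ^ q ≤ F k x)
    {x y : X} (hx : x ∈ Ω) (hy : y ∈ Ω) :
    ENNReal.ofReal (dist (φ x) (φ y) ^ q / dist x y ^ (q + 1)) ≤
      ediam (φ '' Ω) ^ q * 2 ^ (q + 1) + ∑' k : {k : ℕ // 1 ≤ k},
        (closedBall x (2⁻¹ ^ k.1)).indicator (fun _ => 2 ^ ((k.1 + 1) * (q + 1)) * F k x) y := by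
  rcases eq_or_ne x y with rfl | hxy
  · simp [Real.zero_rpow hq.ne']
  rcases le_or_gt (dist x y) 2⁻¹ with hd | hd
  · obtain ⟨k, hk, hlt, hle⟩ := exists_two_inv_pow_lt_le (dist_pos.2 hxy) hd
    refine (le_trans ?_ (ENNReal.le_tsum (⟨k, hk⟩ : {k : ℕ // 1 ≤ k}))).trans le_add_self
    rw [indicator_of_mem (mem_closedBall'.2 hle), mul_comm]
    calc _ ≤ edist (φ x) (φ y) ^ q * 2 ^ (((k + 1 : ℕ) : ℝ) * (q + 1)) :=
          ofReal_dist_rpow_div_le hq φ hlt.le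
      _ ≤ F k x * 2 ^ (((k + 1 : ℕ) : ℝ) * (q + 1)) :=
          mul_le_mul_left (hF k hk x hx y hy hle) _
      _ = F k x * 2 ^ (((k : ℝ) + 1) * (q + 1)) := by rw [Nat.cast_succ]
  · calc _ ≤ edist (φ x) (φ y) ^ q * 2 ^ (((1 : ℕ) : ℝ) * (q + 1)) :=
          ofReal_dist_rpow_div_le hq φ (by simpa using hd.le)
      _ ≤ ediam (φ '' Ω) ^ q * 2 ^ (q + 1) := by
          rw [Nat.cast_one, one_mul]
          gcongr
          exact edist_le_ediam_of_mem (mem_image_of_mem φ hx) (mem_image_of_mem φ hy)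
      _ ≤ _ := le_self_add

lemma IsDyadicCovering.exists_edist_rpow_le_nearbyDiameterSum {Ω : Set X} {ι : ℕ → Type}
    [∀ k, Fintype (ι k)] {Q : ∀ k, ι k → Set X} (hQ : IsDyadicCovering Ω Q)
    (hconn : ∀ x ∈ Ω, ∀ y ∈ Ω, ∃ K ⊆ Ω ∩ closedBall x (dist x y),
      IsPreconnected K ∧ x ∈ K ∧ y ∈ K)
    (hq : 0 < q) (hφ : Continuous φ) :
    ∃ D : ℝ, 0 < D ∧ ∃ (p : ∀ k, ι k → X) (M : ℕ), ∀ k, ∀ x ∈ Ω, ∀ y ∈ Ω, dist x y ≤ 2⁻¹ ^ k →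
      edist (φ x) (φ y) ^ q ≤ M ^ q * nearbyDiameterSum (Q k) (p k) (D * 2⁻¹ ^ k) q φ x := by
  obtain ⟨D, hD, p, hp⟩ := hQ.exists_center
  obtain ⟨M, hM⟩ := hQ.exists_ncard_le 1
  refine ⟨D + 1, by positivity, p, M, fun k x hx y hy hxy => ?_⟩
  obtain ⟨K, hKsub, hK, hxK, hyK⟩ := hconn x hx y hy
  obtain ⟨hKΩ, hKball⟩ := subset_inter_iff.1 hKsub
  rw [add_one_mul]
  exact edist_rpow_le_nearbyDiameterSum (fun j => (hp k j).2) hq hφ (by simpa using hM k x) hK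
    (hKΩ.trans (hQ.iUnion_eq k).ge) (hKball.trans (closedBall_subset_closedBall hxy)) hxK hyK

variable [MeasurableSpace X] [OpensMeasurableSpace X] {μ : Measure X}

lemma measurable_nearbyDiameterSum {ι : Type*} [Fintype ι] (Q : ι → Set X) (p : ι → X) (R : ℝ) :
    Measurable (nearbyDiameterSum Q p R q φ) :=
  Finset.measurable_fun_sum _ fun _ _ =>
    measurable_const.indicator isClosed_closedBall.measurableSet

lemma lintegral_nearbyDiameterSum_le {ι : Type*} [Fintype ι] (Q : ι → Set X) (p : ι → X) {R : ℝ}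
    {V : ℝ≥0∞} (hV : ∀ j, μ (closedBall (p j) R) ≤ V) :
    ∫⁻ x, nearbyDiameterSum Q p R q φ x ∂μ ≤ V * ∑ j, ediam (φ '' Q j) ^ q := by
  have hball (j : ι) : MeasurableSet (closedBall (p j) R) := isClosed_closedBall.measurableSet
  calc ∫⁻ x, nearbyDiameterSum Q p R q φ x ∂μ
      = ∑ j, ediam (φ '' Q j) ^ q * μ (closedBall (p j) R) := by
        simp only [nearbyDiameterSum]
        rw [lintegral_finsetSum _ fun j _ => measurable_const.indicator (hball j)]
        simp only [lintegral_indicator_const (hball _)]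
    _ ≤ V * ∑ j, ediam (φ '' Q j) ^ q := by
        rw [mul_comm, Finset.sum_mul]
        gcongr with j
        exact hV j

lemma gagliardoEnergy_le_add_tsum {Ω : Set X} (hΩ : ∀ᵐ x ∂μ, x ∈ Ω) {C : ℝ≥0∞}
    (hμ : ∀ x r, μ (closedBall x r) ≤ C * ENNReal.ofReal r ^ 2) (hq : 0 < q)
    {F : ℕ → X → ℝ≥0∞} (hFm : ∀ k, Measurable (F k))
    (hF : ∀ k, 1 ≤ k → ∀ x ∈ Ω, ∀ y ∈ Ω, dist x y ≤ 2⁻¹ ^ k → edist (φ x) (φ y) ^ q ≤ F k x) :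
    gagliardoEnergy μ q φ ≤ ediam (φ '' Ω) ^ q * 2 ^ (q + 1) * μ univ * μ univ +
      ∑' k : {k : ℕ // 1 ≤ k}, C * (2 ^ (-(k.1 : ℝ))) ^ 2 * 2 ^ ((k.1 + 1) * (q + 1)) *
        ∫⁻ x, F k x ∂μ := by
  have hinner : ∀ x ∈ Ω,
      ∫⁻ y, ENNReal.ofReal (dist (φ x) (φ y) ^ q / dist x y ^ (q + 1)) ∂μ ≤
        ediam (φ '' Ω) ^ q * 2 ^ (q + 1) * μ univ + ∑' k : {k : ℕ // 1 ≤ k},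
          C * (2 ^ (-(k.1 : ℝ))) ^ 2 * 2 ^ ((k.1 + 1) * (q + 1)) * F k x := fun x hx => by
    have hball (k : ℕ) : MeasurableSet (closedBall x (2⁻¹ ^ k)) := isClosed_closedBall.measurableSet
    refine (lintegral_mono_ae
      (hΩ.mono fun y hy => ofReal_dist_rpow_div_le_add_tsum hq hF hx hy)).trans ?_
    rw [lintegral_add_left measurable_const, lintegral_const,
      lintegral_tsum fun k : {k : ℕ // 1 ≤ k} =>
        (measurable_const.indicator (hball k.1)).aemeasurable]
    gcongr with k
    rw [lintegral_indicator_const (hball k.1), mul_comm, ← ofReal_two_inv_pow, mul_assoc]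
    gcongr
    exact hμ _ _
  calc gagliardoEnergy μ q φ ≤ ∫⁻ x, (ediam (φ '' Ω) ^ q * 2 ^ (q + 1) * μ univ +
        ∑' k : {k : ℕ // 1 ≤ k},
          C * (2 ^ (-(k.1 : ℝ))) ^ 2 * 2 ^ ((k.1 + 1) * (q + 1)) * F k x) ∂μ :=
        lintegral_mono_ae (hΩ.mono hinner)
    _ = _ := by
        rw [lintegral_add_left measurable_const, lintegral_const,
          lintegral_tsum fun k : {k : ℕ // 1 ≤ k} => ((hFm k.1).const_mul _).aemeasurable]
        simp only [lintegral_const_mul _ (hFm _)]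

theorem gagliardoEnergy_lt_top_of_diameterSum_lt_top [IsFiniteMeasure μ] {Ω : Set X}
    (hΩ : ∀ᵐ x ∂μ, x ∈ Ω) {C : ℝ≥0∞} (hC : C ≠ ⊤)
    (hμ : ∀ x r, μ (closedBall x r) ≤ C * ENNReal.ofReal r ^ 2)
    {ι : ℕ → Type} [∀ k, Fintype (ι k)] {Q : ∀ k, ι k → Set X} (hQ : IsDyadicCovering Ω Q)
    (hconn : ∀ x ∈ Ω, ∀ y ∈ Ω, ∃ K ⊆ Ω ∩ closedBall x (dist x y),
      IsPreconnected K ∧ x ∈ K ∧ y ∈ K)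
    (hq : 0 < q) (hφ : Continuous φ) (hb : ediam (φ '' Ω) ≠ ⊤)
    (hsum : diameterSum Q q φ < ⊤) : gagliardoEnergy μ q φ < ⊤ := by
  obtain ⟨D, hD, p, M, hF⟩ := hQ.exists_edist_rpow_le_nearbyDiameterSum hconn hq hφ
  set F : ℕ → X → ℝ≥0∞ := fun k x => M ^ q * nearbyDiameterSum (Q k) (p k) (D * 2⁻¹ ^ k) q φ x
  have hFm (k : ℕ) : Measurable (F k) := (measurable_nearbyDiameterSum _ _ _).const_mul _
  have hterm (k : ℕ) :
      C * (2 ^ (-(k : ℝ))) ^ 2 * 2 ^ ((k + 1) * (q + 1)) * ∫⁻ x, F k x ∂μ ≤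
        M ^ q * 2 ^ (q + 1) * (C * C) * ENNReal.ofReal D ^ 2 *
          (2 ^ (k * (q - 3)) * ∑ j, ediam (φ '' Q k j) ^ q) := by
    have hexp : (2 : ℝ≥0∞) ^ (((k : ℝ) + 1) * (q + 1)) * (2 ^ (-(k : ℝ))) ^ 4 =
        2 ^ (q + 1) * 2 ^ (k * (q - 3)) := by
      rw [← ENNReal.rpow_mul_natCast, ← two_rpow_add, ← two_rpow_add]
      congr 1
      push_cast
      ring
    have hvol (j : ι k) : μ (closedBall (p k j) (D * 2⁻¹ ^ k)) ≤
        C * (ENNReal.ofReal D * 2 ^ (-(k : ℝ))) ^ 2 := by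
      rw [← ofReal_two_inv_pow, ← ENNReal.ofReal_mul hD.le]
      exact hμ _ _
    calc C * (2 ^ (-(k : ℝ))) ^ 2 * 2 ^ (((k : ℝ) + 1) * (q + 1)) * ∫⁻ x, F k x ∂μ
        ≤ C * (2 ^ (-(k : ℝ))) ^ 2 * 2 ^ (((k : ℝ) + 1) * (q + 1)) * (M ^ q *
          (C * (ENNReal.ofReal D * 2 ^ (-(k : ℝ))) ^ 2 *
            ∑ j, ediam (φ '' Q k j) ^ q)) := by
          rw [lintegral_const_mul _ (measurable_nearbyDiameterSum _ _ _)]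
          gcongr
          exact lintegral_nearbyDiameterSum_le _ _ hvol
      _ = (2 ^ (((k : ℝ) + 1) * (q + 1)) * (2 ^ (-(k : ℝ))) ^ 4) * (M ^ q * (C * C) *
          ENNReal.ofReal D ^ 2 * ∑ j, ediam (φ '' Q k j) ^ q) := by ring
      _ = _ := by
          rw [hexp]
          ring
  refine (gagliardoEnergy_le_add_tsum hΩ hμ hq hFm fun k _ => hF k).trans_lt
    (ENNReal.add_lt_top.2 ⟨?_, ?_⟩)
  · finiteness
  · refine (ENNReal.tsum_le_tsum fun k : {k : ℕ // 1 ≤ k} => hterm k).trans_lt ?_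
    rw [ENNReal.tsum_mul_left]
    exact ENNReal.mul_lt_top (by finiteness) hsum

end DiameterSumToGagliardo

section Oscillation

open Metric Filter Topology

variable {X Y : Type*} [MeasurableSpace X] [MetricSpace Y] {μ : Measure X} {q : ℝ} {φ : X → Y}
  {B B' : Set X}

/-- The double integral of `|φ x - φ y| ^ q` over `B × B`, the unnormalised `q`-mean oscillation
of `φ` on `B`. -/
noncomputable def oscillationEnergy (μ : Measure X) (q : ℝ) (φ : X → Y) (B : Set X) : ℝ≥0∞ :=
  ∫⁻ x in B, ∫⁻ y in B, edist (φ x) (φ y) ^ q ∂μ ∂μ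

/-- A point `c` of `B` for which the `q`-mean distance of `φ c` from `φ` on `B` is at most its
average over all choices of `c`. The value `φ c` takes the role of the mean of `φ` over `B`, which
makes no sense in a metric space. -/
structure IsMeanCenter (μ : Measure X) (q : ℝ) (φ : X → Y) (B : Set X) (c : X) : Prop where
  mem : c ∈ B
  lintegral_le : ∫⁻ y in B, edist (φ c) (φ y) ^ q ∂μ ≤ (μ B)⁻¹ * oscillationEnergy μ q φ B

lemma oscillationEnergy_mono (h : B' ⊆ B) :
    oscillationEnergy μ q φ B' ≤ oscillationEnergy μ q φ B :=
  (lintegral_mono_set h).trans (lintegral_mono fun _ => lintegral_mono_set h)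

variable [MetricSpace X] [BorelSpace X]

lemma edist_rpow_le_of_isMeanCenter (hq : 1 ≤ q) (hφ : Continuous φ) (h : B' ⊆ B) (h0 : μ B' ≠ 0)
    (htop : μ B' ≠ ⊤) {c c' : X} (hc : IsMeanCenter μ q φ B c) (hc' : IsMeanCenter μ q φ B' c') :
    edist (φ c) (φ c') ^ q ≤ 2 ^ q * (μ B')⁻¹ ^ 2 * oscillationEnergy μ q φ B := by
  have hmeas : Measurable fun y => edist (φ c) (φ y) ^ q :=
    (continuous_const.edist hφ).measurable.pow_const q
  have htriangle (y : X) : edist (φ c) (φ c') ^ q ≤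
      2 ^ (q - 1) * (edist (φ c) (φ y) ^ q + edist (φ c') (φ y) ^ q) :=
    (ENNReal.rpow_le_rpow (edist_triangle_right _ _ (φ y)) (by linarith)).trans
      (ENNReal.rpow_add_le_mul_rpow_add_rpow _ _ hq)
  have hB : ∫⁻ y in B', edist (φ c) (φ y) ^ q ∂μ ≤ (μ B')⁻¹ * oscillationEnergy μ q φ B :=
    calc _ ≤ (μ B)⁻¹ * oscillationEnergy μ q φ B := (lintegral_mono_set h).trans hc.lintegral_le
      _ ≤ (μ B')⁻¹ * oscillationEnergy μ q φ B := by gcongr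
  have hB' : ∫⁻ y in B', edist (φ c') (φ y) ^ q ∂μ ≤ (μ B')⁻¹ * oscillationEnergy μ q φ B :=
    hc'.lintegral_le.trans (mul_le_mul_right (oscillationEnergy_mono h) _)
  calc edist (φ c) (φ c') ^ q = (μ B')⁻¹ * ∫⁻ _ in B', edist (φ c) (φ c') ^ q ∂μ := by
        rw [setLIntegral_const, mul_left_comm, ENNReal.inv_mul_cancel h0 htop, mul_one]
    _ ≤ (μ B')⁻¹ * ∫⁻ y in B',
          2 ^ (q - 1) * (edist (φ c) (φ y) ^ q + edist (φ c') (φ y) ^ q) ∂μ := by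
        gcongr with y
        exact htriangle y
    _ = (μ B')⁻¹ * (2 ^ (q - 1) * (∫⁻ y in B', edist (φ c) (φ y) ^ q ∂μ +
          ∫⁻ y in B', edist (φ c') (φ y) ^ q ∂μ)) := by
        rw [lintegral_const_mul' _ _ (by simp), lintegral_add_left hmeas]
    _ ≤ (μ B')⁻¹ * (2 ^ (q - 1) * ((μ B')⁻¹ * oscillationEnergy μ q φ B +
          (μ B')⁻¹ * oscillationEnergy μ q φ B)) := by gcongr
    _ = 2 ^ (q - 1) * 2 ^ (1 : ℝ) * (μ B')⁻¹ ^ 2 * oscillationEnergy μ q φ B := by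
        rw [ENNReal.rpow_one]
        ring
    _ = 2 ^ q * (μ B')⁻¹ ^ 2 * oscillationEnergy μ q φ B := by
        rw [← two_rpow_add, sub_add_cancel]

variable [SecondCountableTopology X] [SFinite μ]

lemma measurable_edist_rpow (hφ : Continuous φ) :
    Measurable fun z : X × X => edist (φ z.1) (φ z.2) ^ q :=
  ((hφ.comp continuous_fst).edist (hφ.comp continuous_snd)).measurable.pow_const q

lemma exists_isMeanCenter (hφ : Continuous φ) (h0 : μ B ≠ 0) (htop : μ B ≠ ⊤) :
    ∃ c, IsMeanCenter μ q φ B c := by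
  obtain ⟨c, hcB, hc⟩ := exists_le_setLAverage h0 htop
    (f := fun x => ∫⁻ y in B, edist (φ x) (φ y) ^ q ∂μ)
    (measurable_edist_rpow hφ).lintegral_prod_right'.aemeasurable
  refine ⟨c, hcB, hc.trans_eq ?_⟩
  rw [setLAverage_eq, div_eq_mul_inv, mul_comm, oscillationEnergy]

lemma edist_rpow_le_tsum_oscillationEnergy (hq : 1 ≤ q) (hφ : Continuous φ) {B : ℕ → Set X}
    {x c₀ : X} (hB : Antitone B) (hBx : Tendsto B atTop (𝓝 x).smallSets) (h0 : ∀ i, μ (B i) ≠ 0)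
    (htop : ∀ i, μ (B i) ≠ ⊤) (hc₀ : IsMeanCenter μ q φ (B 0) c₀) (ε : ℝ) :
    edist (φ c₀) (φ x) ^ q ≤ geometricSum (ε / q) ^ q * ∑' i : ℕ, 2 ^ (i * ε) *
      (2 ^ q * (μ (B (i + 1)))⁻¹ ^ 2 * oscillationEnergy μ q φ (B i)) := by
  obtain ⟨c, rfl, hc⟩ : ∃ c : ℕ → X, c 0 = c₀ ∧ ∀ i, IsMeanCenter μ q φ (B i) (c i) := by
    choose b hb using fun i => exists_isMeanCenter (q := q) hφ (h0 i) (htop i)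
    refine ⟨fun | 0 => c₀ | i + 1 => b (i + 1), rfl, ?_⟩
    rintro (_ | i)
    exacts [hc₀, hb (i + 1)]
  have hlim : Tendsto (fun i => φ (c i)) atTop (𝓝 (φ x)) :=
    (hφ.tendsto x).comp (hBx.of_smallSets (Eventually.of_forall fun i => (hc i).mem))
  have hq0 : 0 < q := by linarith
  calc edist (φ (c 0)) (φ x) ^ q ≤ (∑' i, edist (φ (c i)) (φ (c (i + 1)))) ^ q := by
        gcongr
        exact edist_le_tsum_of_edist_le_of_tendsto₀ _ (fun _ => le_rfl) hlim
    _ ≤ geometricSum (ε / q) ^ q *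
          ∑' i : ℕ, 2 ^ (i * ε) * edist (φ (c i)) (φ (c (i + 1))) ^ q :=
        tsum_rpow_le_geometricSum _ hq0 ε
    _ ≤ _ := by
        gcongr with i
        exact edist_rpow_le_of_isMeanCenter hq hφ (hB i.le_succ) (h0 _) (htop _) (hc i) (hc _)

end Oscillation

section BallEnergy

open Metric

variable {X Y : Type*} [MetricSpace X] [MetricSpace Y] {q : ℝ}

lemma tsum_indicator_closedBall_le (hq : 0 < q) (φ : X → Y) {ρ : ℝ} (hρ : 0 < ρ) (u v : X) :
    ∑' j : ℕ, 2 ^ (j * (q + 1)) *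
        (closedBall u (ρ * 2⁻¹ ^ j)).indicator (fun v => edist (φ u) (φ v) ^ q) v ≤
      2 ^ (q + 1) * ENNReal.ofReal (ρ⁻¹ ^ (-(q + 1))) *
        ENNReal.ofReal (dist (φ u) (φ v) ^ q / dist u v ^ (q + 1)) := by
  classical
  rcases eq_or_ne u v with rfl | huv
  · simp [indicator_apply, ENNReal.zero_rpow_of_pos hq]
  have hterm (j : ℕ) : 2 ^ (j * (q + 1)) *
      (closedBall u (ρ * 2⁻¹ ^ j)).indicator (fun v => edist (φ u) (φ v) ^ q) v =
      {j : ℕ | dist u v ≤ ρ * 2⁻¹ ^ j}.indicator (fun j => (2 : ℝ≥0∞) ^ (j * (q + 1))) j *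
        edist (φ u) (φ v) ^ q := by
    simp only [indicator_apply, mem_closedBall', mem_ofPred_eq, mul_ite, mul_zero,
      ite_mul, zero_mul]
  rw [tsum_congr hterm, ENNReal.tsum_mul_right, ofReal_dist_rpow_div hq]
  calc _ ≤ 2 ^ (q + 1) * ENNReal.ofReal ((dist u v / ρ) ^ (-(q + 1))) *
        edist (φ u) (φ v) ^ q := by
        gcongr
        exact tsum_two_rpow_indicator_le (by linarith) (dist_pos.2 huv) hρ
    _ = _ := by
        rw [div_eq_inv_mul, Real.mul_rpow (by positivity) dist_nonneg,
          ENNReal.ofReal_mul (by positivity)]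
        ring

variable [MeasurableSpace X] {μ : Measure X} {φ : X → Y}

/-- The integral of `|φ u - φ v| ^ q` over the points `v` with `|u - v| ≤ R`: the part of the
inner Gagliardo integral at `u` that comes from distances at most `R`, without the kernel. -/
noncomputable def ballEnergy (μ : Measure X) (q : ℝ) (φ : X → Y) (R : ℝ) (u : X) : ℝ≥0∞ :=
  ∫⁻ v in closedBall u R, edist (φ u) (φ v) ^ q ∂μ

lemma oscillationEnergy_le_lintegral_ballEnergy {B S : Set X} (hB : MeasurableSet B) (hS : B ⊆ S)
    {R : ℝ} (hR : ∀ u ∈ B, B ⊆ closedBall u R) :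
    oscillationEnergy μ q φ B ≤ ∫⁻ u in S, ballEnergy μ q φ R u ∂μ :=
  (setLIntegral_mono' hB fun u hu => lintegral_mono_set (hR u hu)).trans (lintegral_mono_set hS)

lemma ballEnergy_eq_lintegral_indicator [OpensMeasurableSpace X] (R : ℝ) (u : X) :
    ballEnergy μ q φ R u =
      ∫⁻ v, (closedBall u R).indicator (fun v => edist (φ u) (φ v) ^ q) v ∂μ :=
  (lintegral_indicator isClosed_closedBall.measurableSet _).symm

variable [BorelSpace X] [SecondCountableTopology X] [SFinite μ]

lemma measurable_ballEnergy (hφ : Continuous φ) (R : ℝ) : Measurable (ballEnergy μ q φ R) := by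
  have hclosed : IsClosed {z : X × X | dist z.2 z.1 ≤ R} :=
    isClosed_le (continuous_snd.dist continuous_fst) continuous_const
  rw [funext (ballEnergy_eq_lintegral_indicator R)]
  exact ((measurable_edist_rpow hφ).indicator hclosed.measurableSet).lintegral_prod_right'

lemma tsum_lintegral_ballEnergy_le (hq : 0 < q) (hφ : Continuous φ) {ρ : ℝ} (hρ : 0 < ρ) :
    ∑' j : ℕ, 2 ^ (j * (q + 1)) * ∫⁻ u, ballEnergy μ q φ (ρ * 2⁻¹ ^ j) u ∂μ ≤
      2 ^ (q + 1) * ENNReal.ofReal (ρ⁻¹ ^ (-(q + 1))) * gagliardoEnergy μ q φ := by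
  have hball (j : ℕ) := measurable_ballEnergy (μ := μ) (q := q) hφ (ρ * 2⁻¹ ^ j)
  have hind (u : X) (j : ℕ) : Measurable
      ((closedBall u (ρ * 2⁻¹ ^ j)).indicator fun v => edist (φ u) (φ v) ^ q) :=
    ((continuous_const.edist hφ).measurable.pow_const q).indicator
      isClosed_closedBall.measurableSet
  have hK : (2 : ℝ≥0∞) ^ (q + 1) * ENNReal.ofReal (ρ⁻¹ ^ (-(q + 1))) ≠ ⊤ := by finiteness
  calc ∑' j : ℕ, 2 ^ (j * (q + 1)) * ∫⁻ u, ballEnergy μ q φ (ρ * 2⁻¹ ^ j) u ∂μ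
      = ∫⁻ u, ∫⁻ v, ∑' j : ℕ, 2 ^ (j * (q + 1)) *
          (closedBall u (ρ * 2⁻¹ ^ j)).indicator (fun v => edist (φ u) (φ v) ^ q) v ∂μ ∂μ := by
        simp only [← lintegral_const_mul _ (hball _)]
        rw [← lintegral_tsum fun j => ((hball j).const_mul _).aemeasurable]
        congr! 2 with u
        rw [lintegral_tsum fun j => ((hind u j).const_mul _).aemeasurable]
        simp only [lintegral_const_mul _ (hind u _), ballEnergy_eq_lintegral_indicator]
    _ ≤ ∫⁻ u, ∫⁻ v, 2 ^ (q + 1) * ENNReal.ofReal (ρ⁻¹ ^ (-(q + 1))) *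
          ENNReal.ofReal (dist (φ u) (φ v) ^ q / dist u v ^ (q + 1)) ∂μ ∂μ := by
        gcongr with u v
        exact tsum_indicator_closedBall_le hq φ hρ u v
    _ = _ := by simp only [lintegral_const_mul' _ _ hK, gagliardoEnergy]

end BallEnergy

section ShrinkingBalls

open Metric Filter Topology

variable {X : Type*} [MetricSpace X] {x₀ x : X} {r : ℝ}

/-- The ball of radius `4 * r` about `x₀`, followed by the balls of radii `r, r / 2, r / 4, …`
about `x`: for `x` on a sphere about `x₀` with radius in `[r, 2 * r]` these lead from a set that
does not depend on `x` to `x` itself. -/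
def shrinkingBalls (x₀ x : X) (r : ℝ) : ℕ → Set X
  | 0 => closedBall x₀ (4 * r)
  | i + 1 => closedBall x (r * 2⁻¹ ^ i)

lemma measurableSet_shrinkingBalls [MeasurableSpace X] [OpensMeasurableSpace X] (x₀ x : X) (r : ℝ) :
    ∀ i, MeasurableSet (shrinkingBalls x₀ x r i)
  | 0 => isClosed_closedBall.measurableSet
  | _ + 1 => isClosed_closedBall.measurableSet

lemma antitone_shrinkingBalls (hr : 0 < r) (hx : dist x x₀ ≤ 2 * r) :
    Antitone (shrinkingBalls x₀ x r) := by
  refine antitone_nat_of_succ_le ?_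
  rintro (_ | i)
  · exact closedBall_subset_closedBall' (by rw [pow_zero]; linarith)
  · refine closedBall_subset_closedBall (mul_le_mul_of_nonneg_left ?_ hr.le)
    exact pow_le_pow_of_le_one (by norm_num) (by norm_num) i.le_succ

lemma tendsto_shrinkingBalls (x₀ x : X) (r : ℝ) :
    Tendsto (shrinkingBalls x₀ x r) atTop (𝓝 x).smallSets :=
  (tendsto_add_atTop_iff_nat 1).1
    ((tendsto_closedBall_smallSets x).comp (tendsto_mul_two_inv_pow r))

lemma shrinkingBalls_subset_closedBall (hr : 0 < r) {i : ℕ} {u : X}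
    (hu : u ∈ shrinkingBalls x₀ x r i) :
    shrinkingBalls x₀ x r i ⊆ closedBall u (8 * (r * 2⁻¹ ^ i)) := by
  obtain _ | i := i
  · exact closedBall_subset_closedBall' (by
      have := mem_closedBall'.1 hu
      linarith)
  · refine closedBall_subset_closedBall' ?_
    have := mem_closedBall'.1 hu
    have hpos : 0 < r * 2⁻¹ ^ i := by positivity
    rw [pow_succ]
    linarith

/-- The closed annulus of half-width `R` around the sphere of radius `t` about `x₀`. -/
def annulus (x₀ : X) (t R : ℝ) : Set X := {u | |dist u x₀ - t| ≤ R}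

lemma shrinkingBalls_subset_annulus (hr : 0 < r) (hx : dist x x₀ ∈ Icc r (2 * r)) (i : ℕ) :
    shrinkingBalls x₀ x r i ⊆
      closedBall x₀ (4 * r) ∩ annulus x₀ (dist x x₀) (8 * (r * 2⁻¹ ^ i)) := by
  refine subset_inter (antitone_shrinkingBalls hr hx.2 i.zero_le) fun u hu => ?_
  obtain _ | i := i
  · have hu : dist u x₀ ≤ 4 * r := hu
    have hpos : 0 ≤ dist u x₀ := dist_nonneg
    rw [annulus, mem_ofPred_eq, abs_le, pow_zero]
    constructor <;> linarith [hx.1, hx.2]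
  · have hu : dist u x ≤ r * 2⁻¹ ^ i := hu
    have hpos : 0 < r * 2⁻¹ ^ i := by positivity
    rw [annulus, mem_ofPred_eq, pow_succ]
    linarith [abs_dist_sub_le u x x₀]

end ShrinkingBalls

section Spheres

open Metric

/-- The constant of the estimate for the diameter of the image of a sphere in terms of the energies
of a map over balls shrinking to the points of the sphere. -/
noncomputable def telescopingConstant (c : ℝ≥0∞) (q ε : ℝ) : ℝ≥0∞ :=
  4 ^ q * geometricSum (ε / q) ^ q * c⁻¹ ^ 2

lemma telescopingConstant_ne_top {c : ℝ≥0∞} (hc : c ≠ 0) {q ε : ℝ} (hq : 0 < q) (hε : 0 < ε) :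
    telescopingConstant c q ε ≠ ⊤ := by
  have hsum : geometricSum (ε / q) ≠ ⊤ := geometricSum_ne_top (div_pos hε hq)
  rw [telescopingConstant]
  finiteness

lemma ediam_image_rpow_le {X Y : Type*} [MetricSpace Y] {φ : X → Y} {S : Set X} {c : X} {q : ℝ}
    (hq : 0 < q) {M : ℝ≥0∞} (h : ∀ x ∈ S, edist (φ c) (φ x) ^ q ≤ M) :
    ediam (φ '' S) ^ q ≤ 2 ^ q * M := by
  have hle : ediam (φ '' S) ≤ 2 * M ^ q⁻¹ := by
    refine ediam_le ?_
    rintro _ ⟨x, hx, rfl⟩ _ ⟨y, hy, rfl⟩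
    rw [two_mul]
    exact (edist_triangle_left _ _ (φ c)).trans (add_le_add
      ((ENNReal.le_rpow_inv_iff hq).2 (h x hx)) ((ENNReal.le_rpow_inv_iff hq).2 (h y hy)))
  calc ediam (φ '' S) ^ q ≤ (2 * M ^ q⁻¹) ^ q := by gcongr
    _ = 2 ^ q * M := by
      rw [ENNReal.mul_rpow_of_nonneg _ _ hq.le, ENNReal.rpow_inv_rpow hq.ne']

variable {X Y : Type*} [MetricSpace X] [MeasurableSpace X] [BorelSpace X]
  [SecondCountableTopology X] [MetricSpace Y] {μ : Measure X} [IsFiniteMeasure μ] {q : ℝ}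
  {φ : X → Y} {c : ℝ≥0∞} {x₀ x : X} {r t : ℝ}

lemma edist_rpow_le_tsum_annulus (hq : 1 ≤ q) (hφ : Continuous φ) (hc : c ≠ 0) (hr : 0 < r)
    (hlow : ∀ y ∈ closedBall x₀ (2 * r), ∀ s ≤ r, c * ENNReal.ofReal s ^ 2 ≤ μ (closedBall y s))
    (ht : t ∈ Icc r (2 * r)) (hx : x ∈ sphere x₀ t) {c₀ : X}
    (hc₀ : IsMeanCenter μ q φ (closedBall x₀ (4 * r)) c₀) (ε : ℝ) :
    edist (φ c₀) (φ x) ^ q ≤ geometricSum (ε / q) ^ q * ∑' i : ℕ, 2 ^ (i * ε) *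
      (2 ^ q * (c * ENNReal.ofReal (r * 2⁻¹ ^ i) ^ 2)⁻¹ ^ 2 *
        ∫⁻ u in closedBall x₀ (4 * r) ∩ annulus x₀ t (8 * (r * 2⁻¹ ^ i)),
          ballEnergy μ q φ (8 * (r * 2⁻¹ ^ i)) u ∂μ) := by
  obtain rfl : dist x x₀ = t := hx
  have hanti := antitone_shrinkingBalls hr ht.2
  have hμ (i : ℕ) : c * ENNReal.ofReal (r * 2⁻¹ ^ i) ^ 2 ≤ μ (shrinkingBalls x₀ x r (i + 1)) :=
    hlow x ht.2 _ (mul_le_of_le_one_right hr.le (pow_le_one₀ (by norm_num) (by norm_num)))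
  have h0 (i : ℕ) : μ (shrinkingBalls x₀ x r i) ≠ 0 := by
    have hpos : ENNReal.ofReal (r * 2⁻¹ ^ i) ≠ 0 := (ENNReal.ofReal_pos.2 (by positivity)).ne'
    exact ne_bot_of_le_ne_bot (mul_ne_zero hc (pow_ne_zero 2 hpos))
      ((hμ i).trans (measure_mono (hanti i.le_succ)))
  refine (edist_rpow_le_tsum_oscillationEnergy hq hφ hanti (tendsto_shrinkingBalls x₀ x r) h0
    (fun i => measure_ne_top μ _) hc₀ ε).trans ?_
  gcongr with i
  · exact hμ i
  · exact oscillationEnergy_le_lintegral_ballEnergy (measurableSet_shrinkingBalls x₀ x r i)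
      (shrinkingBalls_subset_annulus hr ht i) fun u => shrinkingBalls_subset_closedBall hr

lemma ediam_image_sphere_rpow_le (hq : 1 ≤ q) (hφ : Continuous φ) (hc : c ≠ 0) (hr : 0 < r)
    (hlow : ∀ y ∈ closedBall x₀ (2 * r), ∀ s ≤ r, c * ENNReal.ofReal s ^ 2 ≤ μ (closedBall y s))
    (ht : t ∈ Icc r (2 * r)) (ε : ℝ) :
    ediam (φ '' sphere x₀ t) ^ q ≤ telescopingConstant c q ε * ∑' i : ℕ, 2 ^ (i * ε) *
      ((ENNReal.ofReal (r * 2⁻¹ ^ i))⁻¹ ^ 4 *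
        ∫⁻ u in closedBall x₀ (4 * r) ∩ annulus x₀ t (8 * (r * 2⁻¹ ^ i)),
          ballEnergy μ q φ (8 * (r * 2⁻¹ ^ i)) u ∂μ) := by
  have hμ : μ (closedBall x₀ (4 * r)) ≠ 0 := by
    have hpos : ENNReal.ofReal r ≠ 0 := (ENNReal.ofReal_pos.2 hr).ne'
    refine ne_bot_of_le_ne_bot (mul_ne_zero hc (pow_ne_zero 2 hpos))
      ((hlow x₀ (mem_closedBall_self (by linarith)) r le_rfl).trans (measure_mono ?_))
    exact closedBall_subset_closedBall (by linarith)
  obtain ⟨c₀, hc₀⟩ := exists_isMeanCenter (q := q) hφ hμ (measure_ne_top μ _)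
  have hinv (i : ℕ) : (c * ENNReal.ofReal (r * 2⁻¹ ^ i) ^ 2)⁻¹ ^ 2 =
      c⁻¹ ^ 2 * (ENNReal.ofReal (r * 2⁻¹ ^ i))⁻¹ ^ 4 := by
    have hpos : ENNReal.ofReal (r * 2⁻¹ ^ i) ≠ 0 := (ENNReal.ofReal_pos.2 (by positivity)).ne'
    rw [ENNReal.mul_inv (.inr (by finiteness)) (.inr (pow_ne_zero 2 hpos)), ENNReal.inv_pow]
    ring
  refine (ediam_image_rpow_le (by linarith) fun x hx =>
    edist_rpow_le_tsum_annulus hq hφ hc hr hlow ht hx hc₀ ε).trans_eq ?_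
  simp only [hinv]
  rw [telescopingConstant, show (4 : ℝ≥0∞) = 2 * 2 by norm_num,
    ENNReal.mul_rpow_of_nonneg _ _ (by linarith), ← mul_assoc]
  simp only [← ENNReal.tsum_mul_left]
  congr! 2 with i
  ring

end Spheres

section Averaging

open Metric

lemma sum_setLIntegral_le {X ι : Type*} [MeasurableSpace X] {μ : Measure X} {H : X → ℝ≥0∞}
    [Fintype ι] {s : ι → Set X} (hs : ∀ i, MeasurableSet (s i))
    (hH : Measurable H) {M : ℕ} (hM : ∀ u, {i | u ∈ s i}.ncard ≤ M) :
    ∑ i, ∫⁻ u in s i, H u ∂μ ≤ M * ∫⁻ u, H u ∂μ := by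
  classical
  calc ∑ i, ∫⁻ u in s i, H u ∂μ = ∫⁻ u, {i | u ∈ s i}.ncard * H u ∂μ := by
        simp only [← lintegral_indicator (hs _)]
        rw [← lintegral_finsetSum _ fun i _ => hH.indicator (hs i)]
        congr! 2 with u
        simp only [indicator_apply]
        rw [← Finset.sum_filter, Finset.sum_const, nsmul_eq_mul, ← Set.ncard_coe_finset,
          Finset.coe_filter_univ]
    _ ≤ M * ∫⁻ u, H u ∂μ := by
        rw [← lintegral_const_mul _ hH]
        gcongr with u
        exact hM u

variable {X : Type*} [MetricSpace X] [MeasurableSpace X] {μ : Measure X}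

lemma setLIntegral_annulus_eq [OpensMeasurableSpace X] (A : Set X) (x₀ : X) (t R : ℝ)
    (H : X → ℝ≥0∞) :
    ∫⁻ u in A ∩ annulus x₀ t R, H u ∂μ =
      ∫⁻ u in A, {z : ℝ × X | |dist z.2 x₀ - z.1| ≤ R}.indicator (fun z => H z.2) (t, u) ∂μ := by
  have hmeas : MeasurableSet (annulus x₀ t R) :=
    (isClosed_le ((continuous_id.dist continuous_const).sub continuous_const).abs
      continuous_const).measurableSet
  rw [inter_comm, ← Measure.restrict_restrict hmeas, ← lintegral_indicator hmeas]
  rfl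

variable [BorelSpace X] [SecondCountableTopology X] {H : X → ℝ≥0∞}

lemma measurable_indicator_annulus (hH : Measurable H) (x₀ : X) (R : ℝ) :
    Measurable ({z : ℝ × X | |dist z.2 x₀ - z.1| ≤ R}.indicator fun z => H z.2) :=
  (hH.comp measurable_snd).indicator (isClosed_le
    ((continuous_snd.dist continuous_const).sub continuous_fst).abs continuous_const).measurableSet

variable [SFinite μ]

lemma measurable_setLIntegral_annulus (hH : Measurable H) (A : Set X) (x₀ : X) (R : ℝ) :
    Measurable fun t => ∫⁻ u in A ∩ annulus x₀ t R, H u ∂μ := by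
  simp only [setLIntegral_annulus_eq]
  exact (measurable_indicator_annulus hH x₀ R).lintegral_prod_right'

lemma lintegral_setLIntegral_annulus (hH : Measurable H) (A : Set X) (x₀ : X) (R : ℝ) :
    ∫⁻ t, ∫⁻ u in A ∩ annulus x₀ t R, H u ∂μ = ENNReal.ofReal (2 * R) * ∫⁻ u in A, H u ∂μ := by
  have hradii (u : X) (t : ℝ) :
      {z : ℝ × X | |dist z.2 x₀ - z.1| ≤ R}.indicator (fun z => H z.2) (t, u) =
        (closedBall (dist u x₀) R).indicator (fun _ => H u) t :=
    indicator_eq_indicator (by rw [mem_closedBall', Real.dist_eq]; rfl) rfl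
  simp only [setLIntegral_annulus_eq]
  rw [lintegral_lintegral_swap (f := fun t u =>
      {z : ℝ × X | |dist z.2 x₀ - z.1| ≤ R}.indicator (fun z => H z.2) (t, u))
      (measurable_indicator_annulus hH x₀ R).aemeasurable,
    ← lintegral_const_mul _ hH]
  simp only [hradii, lintegral_indicator_const isClosed_closedBall.measurableSet,
    Real.volume_closedBall, mul_comm]

lemma inv_ofReal_pow_four_mul {s : ℝ} (hs : 0 < s) :
    (ENNReal.ofReal s)⁻¹ ^ 4 * ENNReal.ofReal (2 * (8 * s)) = 16 * (ENNReal.ofReal s)⁻¹ ^ 3 := by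
  have hinv : (ENNReal.ofReal s)⁻¹ * ENNReal.ofReal s = 1 :=
    ENNReal.inv_mul_cancel (ENNReal.ofReal_pos.2 hs).ne' ENNReal.ofReal_ne_top
  calc (ENNReal.ofReal s)⁻¹ ^ 4 * ENNReal.ofReal (2 * (8 * s))
      = 16 * (ENNReal.ofReal s)⁻¹ ^ 3 * ((ENNReal.ofReal s)⁻¹ * ENNReal.ofReal s) := by
        rw [← mul_assoc 2, ENNReal.ofReal_mul (by norm_num), show (2 : ℝ) * 8 = 16 by norm_num,
          ENNReal.ofReal_ofNat]
        ring
    _ = 16 * (ENNReal.ofReal s)⁻¹ ^ 3 := by rw [hinv, mul_one]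

lemma ediam_image_closedBall_rpow_le {X Y : Type*} [MetricSpace X] [MeasurableSpace X]
    [BorelSpace X] [SecondCountableTopology X] [MetricSpace Y] {μ : Measure X} [IsFiniteMeasure μ]
    {q : ℝ} {φ : X → Y} {c : ℝ≥0∞} {x₀ : X} {r : ℝ} (hq : 1 ≤ q) (hφ : Continuous φ) (hc : c ≠ 0)
    (hr : 0 < r)
    (hlow : ∀ y ∈ closedBall x₀ (2 * r), ∀ s ≤ r, c * ENNReal.ofReal s ^ 2 ≤ μ (closedBall y s))
    (hsphere : ∀ t ∈ Icc r (2 * r), ediam (φ '' closedBall x₀ r) ≤ ediam (φ '' sphere x₀ t))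
    (ε : ℝ) :
    ENNReal.ofReal r * ediam (φ '' closedBall x₀ r) ^ q ≤
      16 * telescopingConstant c q ε * ∑' i : ℕ, 2 ^ (i * ε) *
        ((ENNReal.ofReal (r * 2⁻¹ ^ i))⁻¹ ^ 3 *
          ∫⁻ u in closedBall x₀ (4 * r), ballEnergy μ q φ (8 * (r * 2⁻¹ ^ i)) u ∂μ) := by
  have hball (i : ℕ) := measurable_ballEnergy (μ := μ) (q := q) hφ (8 * (r * 2⁻¹ ^ i))
  have hmeas (i : ℕ) := measurable_setLIntegral_annulus (μ := μ) (hball i) (closedBall x₀ (4 * r))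
    x₀ (8 * (r * 2⁻¹ ^ i))
  calc ENNReal.ofReal r * ediam (φ '' closedBall x₀ r) ^ q
      = ∫⁻ _ in Icc r (2 * r), ediam (φ '' closedBall x₀ r) ^ q := by
        rw [setLIntegral_const, Real.volume_Icc, mul_comm, two_mul, add_sub_cancel_right]
    _ ≤ ∫⁻ t in Icc r (2 * r), telescopingConstant c q ε * ∑' i : ℕ, 2 ^ (i * ε) *
          ((ENNReal.ofReal (r * 2⁻¹ ^ i))⁻¹ ^ 4 *
            ∫⁻ u in closedBall x₀ (4 * r) ∩ annulus x₀ t (8 * (r * 2⁻¹ ^ i)),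
              ballEnergy μ q φ (8 * (r * 2⁻¹ ^ i)) u ∂μ) :=
        setLIntegral_mono' measurableSet_Icc fun t ht =>
          (ENNReal.rpow_le_rpow (hsphere t ht) (by linarith)).trans
            (ediam_image_sphere_rpow_le hq hφ hc hr hlow ht ε)
    _ ≤ ∫⁻ t, telescopingConstant c q ε * ∑' i : ℕ, 2 ^ (i * ε) *
          ((ENNReal.ofReal (r * 2⁻¹ ^ i))⁻¹ ^ 4 *
            ∫⁻ u in closedBall x₀ (4 * r) ∩ annulus x₀ t (8 * (r * 2⁻¹ ^ i)),
              ballEnergy μ q φ (8 * (r * 2⁻¹ ^ i)) u ∂μ) := setLIntegral_le_lintegral _ _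
    _ = _ := by
        rw [lintegral_const_mul _ (Measurable.tsum fun i => ((hmeas i).const_mul _).const_mul _),
          lintegral_tsum fun i => (((hmeas i).const_mul _).const_mul _).aemeasurable, mul_comm 16,
          mul_assoc]
        congr 1
        rw [← ENNReal.tsum_mul_left]
        refine tsum_congr fun i : ℕ => ?_
        rw [lintegral_const_mul _ ((hmeas i).const_mul _), lintegral_const_mul _ (hmeas i),
          lintegral_setLIntegral_annulus (hball i), ← mul_assoc _ (ENNReal.ofReal _),
          inv_ofReal_pow_four_mul (by positivity)]
        ring

end Averaging

section GagliardoToDiameterSum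

open Metric Filter Topology

variable {X Y : Type*} [MetricSpace X] [MetricSpace Y]

lemma ediam_image_closedBall_le_ediam_image_sphere (φ : X ≃ₜ Y) {δ : ℝ≥0∞}
    (hδ : ∀ A : Set Y, ediam A < δ → ediam A ≤ ediam (frontier A)) {x : X} {r t : ℝ} (hrt : r ≤ t)
    (ht : ediam (φ '' closedBall x t) < δ) :
    ediam (φ '' closedBall x r) ≤ ediam (φ '' sphere x t) :=
  calc ediam (φ '' closedBall x r) ≤ ediam (φ '' closedBall x t) :=
        ediam_mono (image_mono (closedBall_subset_closedBall hrt))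
    _ ≤ ediam (frontier (φ '' closedBall x t)) := hδ _ ht
    _ ≤ ediam (φ '' sphere x t) := by
        rw [← φ.image_frontier]
        exact ediam_mono (image_mono frontier_closedBall_subset_sphere)

lemma exists_forall_ediam_image_closedBall_lt {φ : X → Y} (hφ : Continuous φ) {Ω : Set X}
    (hΩ : IsCompact Ω) {δ : ℝ≥0∞} (hδ : 0 < δ) :
    ∃ r > 0, ∀ x ∈ Ω, ediam (φ '' closedBall x r) < δ := by
  obtain ⟨δ', hδ'0, hδ'⟩ := exists_between hδ
  obtain ⟨r, hr, hclose⟩ := mem_uniformity_dist.1 (hΩ.uniformContinuousAt_of_continuousAt φ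
    (fun x _ => hφ.continuousAt) (edist_mem_uniformity (ENNReal.half_pos hδ'0.ne')))
  have hnear : ∀ x ∈ Ω, ∀ y ∈ closedBall x (r / 2), edist (φ x) (φ y) ≤ δ' / 2 := fun x hx y hy =>
    (hclose ((mem_closedBall'.1 hy).trans_lt (half_lt_self hr)) hx).le
  refine ⟨r / 2, half_pos hr, fun x hx => (ediam_le ?_).trans_lt hδ'⟩
  rintro _ ⟨y, hy, rfl⟩ _ ⟨z, hz, rfl⟩
  calc edist (φ y) (φ z) ≤ edist (φ x) (φ y) + edist (φ x) (φ z) := edist_triangle_left _ _ _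
    _ ≤ δ' / 2 + δ' / 2 := add_le_add (hnear x hx y hy) (hnear x hx z hz)
    _ = δ' := ENNReal.add_halves δ'

variable [MeasurableSpace X] [BorelSpace X] [SecondCountableTopology X] {μ : Measure X}
  [IsFiniteMeasure μ] {q : ℝ} {c : ℝ≥0∞}

lemma sum_ediam_image_closedBall_rpow_le {ι : Type*} [Fintype ι] {p : ι → X} {r : ℝ} {φ : X → Y}
    (hq : 1 ≤ q) (hφ : Continuous φ) (hc : c ≠ 0) (hr : 0 < r)
    (hlow : ∀ j, ∀ y ∈ closedBall (p j) (2 * r), ∀ s ≤ r,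
      c * ENNReal.ofReal s ^ 2 ≤ μ (closedBall y s))
    (hsphere : ∀ j, ∀ t ∈ Icc r (2 * r),
      ediam (φ '' closedBall (p j) r) ≤ ediam (φ '' sphere (p j) t))
    {M : ℕ} (hM : ∀ u, {j | u ∈ closedBall (p j) (4 * r)}.ncard ≤ M) (ε : ℝ) :
    ENNReal.ofReal r * ∑ j, ediam (φ '' closedBall (p j) r) ^ q ≤
      16 * M * telescopingConstant c q ε * ∑' i : ℕ, 2 ^ (i * ε) *
        ((ENNReal.ofReal (r * 2⁻¹ ^ i))⁻¹ ^ 3 *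
          ∫⁻ u, ballEnergy μ q φ (8 * (r * 2⁻¹ ^ i)) u ∂μ) := by
  calc ENNReal.ofReal r * ∑ j, ediam (φ '' closedBall (p j) r) ^ q
      ≤ ∑ j, 16 * telescopingConstant c q ε * ∑' i : ℕ, 2 ^ (i * ε) *
        ((ENNReal.ofReal (r * 2⁻¹ ^ i))⁻¹ ^ 3 *
          ∫⁻ u in closedBall (p j) (4 * r), ballEnergy μ q φ (8 * (r * 2⁻¹ ^ i)) u ∂μ) := by
        rw [Finset.mul_sum]
        exact Finset.sum_le_sum fun j _ =>
          ediam_image_closedBall_rpow_le hq hφ hc hr (hlow j) (hsphere j) ε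
    _ = 16 * telescopingConstant c q ε * ∑' i : ℕ, 2 ^ (i * ε) *
        ((ENNReal.ofReal (r * 2⁻¹ ^ i))⁻¹ ^ 3 *
          ∑ j, ∫⁻ u in closedBall (p j) (4 * r), ballEnergy μ q φ (8 * (r * 2⁻¹ ^ i)) u ∂μ) := by
        simp only [Finset.mul_sum, Summable.tsum_finsetSum fun _ _ => ENNReal.summable]
    _ ≤ 16 * telescopingConstant c q ε * ∑' i : ℕ, 2 ^ (i * ε) *
        ((ENNReal.ofReal (r * 2⁻¹ ^ i))⁻¹ ^ 3 *
          (M * ∫⁻ u, ballEnergy μ q φ (8 * (r * 2⁻¹ ^ i)) u ∂μ)) := by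
        gcongr with i
        exact sum_setLIntegral_le (fun j => isClosed_closedBall.measurableSet)
          (measurable_ballEnergy hφ _) hM
    _ = _ := by
        simp only [← ENNReal.tsum_mul_left]
        exact tsum_congr fun i : ℕ => by ring

lemma two_rpow_mul_inv_ofReal_mul_eq {D : ℝ} (hD : 0 < D) (q : ℝ) (k i : ℕ) :
    2 ^ (k * (q - 3)) * ((ENNReal.ofReal (D * 2⁻¹ ^ k))⁻¹ *
        (2 ^ (i * ((q - 2) / 2)) * (ENNReal.ofReal (D * 2⁻¹ ^ (k + i)))⁻¹ ^ 3)) =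
      (ENNReal.ofReal D)⁻¹ ^ 4 *
        (2 ^ (-(i * ((q - 2) / 2))) * 2 ^ (((k + i : ℕ) : ℝ) * (q + 1))) := by
  have hexp : (2 : ℝ≥0∞) ^ (k * (q - 3)) *
      (2 ^ (k : ℝ) * (2 ^ (i * ((q - 2) / 2)) * (2 ^ ((k + i : ℕ) : ℝ)) ^ 3)) =
        2 ^ (-(i * ((q - 2) / 2))) * 2 ^ (((k + i : ℕ) : ℝ) * (q + 1)) := by
    simp only [← ENNReal.rpow_mul_natCast, ← two_rpow_add]
    congr 1
    push_cast
    ring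
  rw [inv_ofReal_mul_two_inv_pow hD, inv_ofReal_mul_two_inv_pow hD, ← hexp]
  ring

lemma two_rpow_mul_sum_ediam_rpow_le {ι : Type*} [Fintype ι] {p : ι → X} {D : ℝ} {k : ℕ}
    {φ : X → Y} (hq : 1 ≤ q) (hφ : Continuous φ) (hc : c ≠ 0) (hD : 0 < D)
    (hlow : ∀ j, ∀ y ∈ closedBall (p j) (2 * (D * 2⁻¹ ^ k)), ∀ s ≤ D * 2⁻¹ ^ k,
      c * ENNReal.ofReal s ^ 2 ≤ μ (closedBall y s))
    (hsphere : ∀ j, ∀ t ∈ Icc (D * 2⁻¹ ^ k) (2 * (D * 2⁻¹ ^ k)),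
      ediam (φ '' closedBall (p j) (D * 2⁻¹ ^ k)) ≤ ediam (φ '' sphere (p j) t))
    {M : ℕ} (hM : ∀ u, {j | u ∈ closedBall (p j) (4 * (D * 2⁻¹ ^ k))}.ncard ≤ M) :
    2 ^ (k * (q - 3)) * ∑ j, ediam (φ '' closedBall (p j) (D * 2⁻¹ ^ k)) ^ q ≤
      16 * M * telescopingConstant c q ((q - 2) / 2) * (ENNReal.ofReal D)⁻¹ ^ 4 *
        ∑' i : ℕ, 2 ^ (-(i * ((q - 2) / 2))) * (2 ^ (((k + i : ℕ) : ℝ) * (q + 1)) *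
          ∫⁻ u, ballEnergy μ q φ (8 * D * 2⁻¹ ^ (k + i)) u ∂μ) := by
  set r := D * 2⁻¹ ^ k with hr_def
  set W : ℕ → ℝ≥0∞ := fun j => ∫⁻ u, ballEnergy μ q φ (8 * D * 2⁻¹ ^ j) u ∂μ
  have hr : 0 < r := by positivity
  have hinv : (ENNReal.ofReal r)⁻¹ * ENNReal.ofReal r = 1 :=
    ENNReal.inv_mul_cancel (ENNReal.ofReal_pos.2 hr).ne' ENNReal.ofReal_ne_top
  have hscale (i : ℕ) : r * 2⁻¹ ^ i = D * 2⁻¹ ^ (k + i) := by rw [hr_def, pow_add, mul_assoc]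
  have hsum := sum_ediam_image_closedBall_rpow_le hq hφ hc hr hlow hsphere hM ((q - 2) / 2)
  simp only [hscale, ← mul_assoc (8 : ℝ)] at hsum
  calc 2 ^ (k * (q - 3)) * ∑ j, ediam (φ '' closedBall (p j) r) ^ q
      = 2 ^ (k * (q - 3)) * ((ENNReal.ofReal r)⁻¹ *
          (ENNReal.ofReal r * ∑ j, ediam (φ '' closedBall (p j) r) ^ q)) := by
        rw [← mul_assoc (ENNReal.ofReal r)⁻¹, hinv, one_mul]
    _ ≤ 2 ^ (k * (q - 3)) * ((ENNReal.ofReal r)⁻¹ *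
          (16 * M * telescopingConstant c q ((q - 2) / 2) * ∑' i : ℕ, 2 ^ (i * ((q - 2) / 2)) *
            ((ENNReal.ofReal (D * 2⁻¹ ^ (k + i)))⁻¹ ^ 3 * W (k + i)))) := by gcongr
    _ = 16 * M * telescopingConstant c q ((q - 2) / 2) * ∑' i : ℕ,
          2 ^ (k * (q - 3)) * ((ENNReal.ofReal r)⁻¹ * (2 ^ (i * ((q - 2) / 2)) *
            (ENNReal.ofReal (D * 2⁻¹ ^ (k + i)))⁻¹ ^ 3)) * W (k + i) := by
        simp only [← ENNReal.tsum_mul_left]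
        exact tsum_congr fun i : ℕ => by ring
    _ = _ := by
        simp only [hr_def, two_rpow_mul_inv_ofReal_mul_eq hD, ← ENNReal.tsum_mul_left]
        exact tsum_congr fun i : ℕ => by ring

lemma IsDyadicCovering.exists_eventually_two_rpow_mul_sum_ediam_rpow_le {ι : ℕ → Type}
    [∀ k, Fintype (ι k)] {Ω : Set X} {Q : ∀ k, ι k → Set X} (hQ : IsDyadicCovering Ω Q)
    {ρ : ℝ} {δ : ℝ≥0∞} (hΩ : IsCompact Ω) (hc : c ≠ 0) (hρ : 0 < ρ)
    (hlow : ∀ x ∈ Ω, ∀ y ∈ closedBall x ρ, ∀ s ≤ ρ, c * ENNReal.ofReal s ^ 2 ≤ μ (closedBall y s))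
    (hδ : 0 < δ) (hY : ∀ A : Set Y, ediam A < δ → ediam A ≤ ediam (frontier A)) (hq : 2 < q)
    (φ : X ≃ₜ Y) :
    ∃ K : ℝ≥0∞, K ≠ ⊤ ∧ ∃ D : ℝ, 0 < D ∧ ∀ᶠ k : ℕ in atTop,
      2 ^ (k * (q - 3)) * ∑ j, ediam (φ '' Q k j) ^ q ≤
        K * ∑' i : ℕ, 2 ^ (-(i * ((q - 2) / 2))) * (2 ^ (((k + i : ℕ) : ℝ) * (q + 1)) *
          ∫⁻ u, ballEnergy μ q φ (D * 2⁻¹ ^ (k + i)) u ∂μ) := by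
  obtain ⟨D, hD, p, hp⟩ := hQ.exists_center
  have hpΩ (k) (j : ι k) : p k j ∈ Ω := hQ.iUnion_eq k ▸ mem_iUnion_of_mem j (hp k j).1
  obtain ⟨M, hM⟩ := hQ.exists_ncard_le (4 * D)
  obtain ⟨r, hr, hsmall⟩ := exists_forall_ediam_image_closedBall_lt φ.continuous hΩ hδ
  have hoverlap (k : ℕ) (u : X) : {j | u ∈ closedBall (p k j) (4 * (D * 2⁻¹ ^ k))}.ncard ≤ M := by
    refine (Set.ncard_le_ncard (fun j hj => ?_) (toFinite _)).trans (hM k u)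
    exact ⟨p k j, (hp k j).1, by rwa [mul_assoc, mem_closedBall_comm]⟩
  refine ⟨16 * M * telescopingConstant c q ((q - 2) / 2) * (ENNReal.ofReal D)⁻¹ ^ 4, ?_, 8 * D,
    by positivity, ?_⟩
  · have hT := telescopingConstant_ne_top (q := q) (ε := (q - 2) / 2) hc (by linarith)
      (by linarith)
    have hD' := (ENNReal.ofReal_pos.2 hD).ne'
    finiteness
  filter_upwards [(tendsto_mul_two_inv_pow (2 * D)).eventually_le_const hρ,
    (tendsto_mul_two_inv_pow (2 * D)).eventually_le_const hr] with k hkρ hkr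
  rw [mul_assoc] at hkρ hkr
  have hDk : 0 < D * 2⁻¹ ^ k := by positivity
  calc 2 ^ (k * (q - 3)) * ∑ j, ediam (φ '' Q k j) ^ q
      ≤ 2 ^ (k * (q - 3)) * ∑ j, ediam (φ '' closedBall (p k j) (D * 2⁻¹ ^ k)) ^ q := by
        gcongr with j
        exact (hp k j).2
    _ ≤ _ := two_rpow_mul_sum_ediam_rpow_le (by linarith) φ.continuous hc hD
        (fun j y hy s hs =>
          hlow _ (hpΩ k j) y (closedBall_subset_closedBall hkρ hy) s (by linarith))
        (fun j t ht => ediam_image_closedBall_le_ediam_image_sphere φ hY ht.1 <|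
          (ediam_mono (image_mono (closedBall_subset_closedBall (ht.2.trans hkr)))).trans_lt
            (hsmall _ (hpΩ k j)))
        (hoverlap k)

theorem diameterSum_lt_top_of_gagliardoEnergy_lt_top {ι : ℕ → Type} [∀ k, Fintype (ι k)]
    {Ω : Set X} {Q : ∀ k, ι k → Set X} {ρ : ℝ} {δ : ℝ≥0∞} (hΩ : IsCompact Ω)
    (hQ : IsDyadicCovering Ω Q) (hc : c ≠ 0) (hρ : 0 < ρ)
    (hlow : ∀ x ∈ Ω, ∀ y ∈ closedBall x ρ, ∀ s ≤ ρ, c * ENNReal.ofReal s ^ 2 ≤ μ (closedBall y s))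
    (hδ : 0 < δ) (hY : ∀ A : Set Y, ediam A < δ → ediam A ≤ ediam (frontier A)) (hq : 2 < q)
    (φ : X ≃ₜ Y) (hE : gagliardoEnergy μ q φ < ⊤) : diameterSum Q q φ < ⊤ := by
  obtain ⟨K, hK, D, hD, hKD⟩ :=
    hQ.exists_eventually_two_rpow_mul_sum_ediam_rpow_le hΩ hc hρ hlow hδ hY hq φ
  set f : ℕ → ℝ≥0∞ := fun k => 2 ^ (k * (q - 3)) * ∑ j, ediam (φ '' Q k j) ^ q
  set w : ℕ → ℝ≥0∞ := fun i => 2 ^ (-(i * ((q - 2) / 2)))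
  set V : ℕ → ℝ≥0∞ := fun j => 2 ^ (j * (q + 1)) * ∫⁻ u, ballEnergy μ q φ (D * 2⁻¹ ^ j) u ∂μ
  have hf (k : ℕ) : f k ≠ ⊤ := by
    have hdiam (j : ι k) : ediam (φ '' Q k j) ≠ ⊤ := ne_top_of_le_ne_top
      (hΩ.image φ.continuous).isBounded.ediam_ne_top
      (ediam_mono (image_mono (hQ.iUnion_eq k ▸ subset_iUnion (Q k) j)))
    refine ENNReal.mul_ne_top (by finiteness) (ENNReal.sum_ne_top.2 fun j _ => ?_)
    exact ENNReal.rpow_ne_top_of_nonneg (by linarith) (hdiam j)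
  have hV : ∑' j, V j ≠ ⊤ := ne_top_of_le_ne_top (by finiteness)
    (tsum_lintegral_ballEnergy_le (by linarith) φ.continuous hD)
  have hw : ∑' i, w i ≠ ⊤ := geometricSum_ne_top (by linarith)
  have hconv : ∑' k, K * ∑' i, w i * V (k + i) ≠ ⊤ := by
    rw [ENNReal.tsum_mul_left]
    exact ENNReal.mul_ne_top hK
      (ne_top_of_le_ne_top (ENNReal.mul_ne_top hw hV) (tsum_tsum_mul_add_le w V))
  calc diameterSum Q q φ ≤ ∑' k, f k :=
        ENNReal.tsum_comp_le_tsum_of_injective Subtype.val_injective f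
    _ < ⊤ := (tsum_ne_top_of_eventually_le hf hKD hconv).lt_top

end GagliardoToDiameterSum

section FrontierDiameter

open Metric

lemma exists_mem_frontier_of_isPreconnected {Y : Type*} [TopologicalSpace Y] {K A : Set Y}
    (hK : IsPreconnected K) {y w : Y} (hy : y ∈ K) (hyA : y ∈ closure A) (hw : w ∈ K)
    (hwA : w ∉ closure A) : ∃ z ∈ K, z ∈ frontier A := by
  by_contra! h
  have hint : ∀ z ∈ K, z ∈ closure A → z ∈ interior A := fun z hz hzA =>
    by_contra fun hzi => h z hz ⟨hzA, hzi⟩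
  have hcov : K ⊆ interior A ∪ (closure A)ᶜ := fun z hz =>
    (em (z ∈ closure A)).imp (hint z hz) id
  obtain ⟨z, -, hzi, hzc⟩ := hK _ _ isOpen_interior isClosed_closure.isOpen_compl hcov
    ⟨y, hy, hint y hy hyA⟩ ⟨w, hw, hwA⟩
  exact hzc (interior_subset_closure hzi)

-- Starting at `y ∈ A` and moving away from `x`, one leaves `A` through a frontier point that is at
-- least as far from `x` as `y`; doing this from both ends of `x, y` gives two frontier points.
lemma ediam_le_ediam_frontier {Y : Type*} [EMetricSpace Y] {δ : ℝ≥0∞}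
    (h : ∀ x y : Y, x ≠ y → ∃ K, IsPreconnected K ∧ y ∈ K ∧ (∀ z ∈ K, edist x y ≤ edist x z) ∧
      ∃ w ∈ K, δ ≤ edist x w) {A : Set Y} (hA : ediam A < δ) :
    ediam A ≤ ediam (frontier A) := by
  have hexit : ∀ x ∈ closure A, ∀ y ∈ closure A, x ≠ y →
      ∃ z ∈ frontier A, edist x y ≤ edist x z := by
    intro x hx y hy hxy
    obtain ⟨K, hK, hyK, hfar, w, hwK, hw⟩ := h x y hxy
    have hwA : w ∉ closure A := fun hwA =>
      ((hw.trans (edist_le_ediam_of_mem hx hwA)).trans_eq (ediam_closure A)).not_gt hA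
    obtain ⟨z, hzK, hz⟩ := exists_mem_frontier_of_isPreconnected hK hyK hy hwK hwA
    exact ⟨z, hz, hfar z hzK⟩
  refine ediam_le fun x hx y hy => ?_
  rcases eq_or_ne x y with rfl | hxy
  · simp
  obtain ⟨z, hz, hxz⟩ := hexit x (subset_closure hx) y (subset_closure hy) hxy
  have hzx : z ≠ x := by
    rintro rfl
    exact hxy (edist_le_zero.1 (hxz.trans_eq (edist_self _)))
  obtain ⟨z', hz', hzz'⟩ := hexit z (frontier_subset_closure hz) x (subset_closure hx) hzx
  calc edist x y ≤ edist z x := hxz.trans_eq (edist_comm x z)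
    _ ≤ edist z z' := hzz'
    _ ≤ ediam (frontier A) := edist_le_ediam_of_mem hz hz'

lemma ediam_le_ediam_frontier_of_normedSpace {E : Type*} [NormedAddCommGroup E] [NormedSpace ℝ E]
    {A : Set E} (hA : ediam A < 1) : ediam A ≤ ediam (frontier A) := by
  refine ediam_le_ediam_frontier (fun x y hxy => ?_) hA
  set ray : ℝ → E := ⇑(AffineMap.lineMap (k := ℝ) x y)
  have hray : ∀ t : ℝ, 0 ≤ t → edist x (ray t) = ENNReal.ofReal (t * dist x y) := fun t ht => by
    rw [edist_dist, dist_left_lineMap, Real.norm_of_nonneg ht]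
  have hd : 0 < dist x y := dist_pos.2 hxy
  have hy : ray 1 = y := AffineMap.lineMap_apply_one x y
  refine ⟨ray '' Ici 1, isPreconnected_Ici.image _ AffineMap.lineMap_continuous.continuousOn,
    ⟨1, self_mem_Ici, hy⟩, ?_, ray (max 1 (dist x y)⁻¹),
    mem_image_of_mem ray (mem_Ici.2 (le_max_left _ _)), ?_⟩
  · rintro _ ⟨t, ht : 1 ≤ t, rfl⟩
    rw [hray t (by linarith), edist_dist]
    exact ENNReal.ofReal_le_ofReal (le_mul_of_one_le_left hd.le ht)
  · rw [hray _ (by positivity), ENNReal.one_le_ofReal, ← inv_le_iff_one_le_mul₀ hd]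
    exact le_max_right _ _

variable {E : Type*} [NormedAddCommGroup E] [InnerProductSpace ℝ E]

lemma exists_ne_zero_inner_eq_zero (hE : 1 < Module.rank ℝ E) (x : E) :
    ∃ v : E, v ≠ 0 ∧ inner ℝ x v = 0 := by
  have hne : (Submodule.span ℝ ({x} : Set E))ᗮ ≠ ⊥ := fun h => by
    rw [Submodule.orthogonal_eq_bot_iff] at h
    have hrank := rank_span_le (R := ℝ) ({x} : Set E)
    rw [h, rank_top, Cardinal.mk_singleton] at hrank
    exact hrank.not_gt hE
  obtain ⟨v, hv, hv0⟩ := Submodule.exists_mem_ne_zero_of_ne_bot hne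
  exact ⟨v, hv0, Submodule.mem_orthogonal_singleton_iff_inner_right.1 hv⟩

lemma exists_norm_eq_one_inner_eq_zero_eq_norm_smul (hE : 1 < Module.rank ℝ E) {x w : E}
    (hxw : inner ℝ x w = 0) : ∃ v, ‖v‖ = 1 ∧ inner ℝ x v = 0 ∧ w = ‖w‖ • v := by
  have hunit : ∀ u : E, u ≠ 0 → inner ℝ x u = 0 →
      ‖‖u‖⁻¹ • u‖ = 1 ∧ inner ℝ x (‖u‖⁻¹ • u) = 0 := fun u hu hxu =>
    ⟨norm_smul_inv_norm hu, by rw [inner_smul_right, hxu, mul_zero]⟩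
  rcases eq_or_ne w 0 with rfl | hw
  · obtain ⟨u, hu, hxu⟩ := exists_ne_zero_inner_eq_zero hE x
    exact ⟨_, (hunit u hu hxu).1, (hunit u hu hxu).2, by simp⟩
  · exact ⟨_, (hunit w hw hxw).1, (hunit w hw hxw).2,
      by rw [smul_inv_smul₀ (norm_ne_zero_iff.2 hw)]⟩

lemma exists_eq_cos_smul_add_sin_smul (hE : 1 < Module.rank ℝ E) {x y : E} (hx : ‖x‖ = 1)
    (hy : ‖y‖ = 1) : ∃ v, ‖v‖ = 1 ∧ inner ℝ x v = 0 ∧ ∃ θ ∈ Icc 0 Real.pi,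
      y = Real.cos θ • x + Real.sin θ • v := by
  set θ := InnerProductGeometry.angle x y
  have hcos : inner ℝ x y = Real.cos θ :=
    InnerProductGeometry.inner_eq_cos_angle_of_norm_eq_one hx hy
  have hsin : 0 ≤ Real.sin θ := InnerProductGeometry.sin_angle_nonneg x y
  have horth : inner ℝ x (y - Real.cos θ • x) = 0 := by
    rw [inner_sub_right, inner_smul_right, hcos, real_inner_self_eq_norm_sq, hx]
    ring
  have hnorm : ‖y - Real.cos θ • x‖ = Real.sin θ := by
    rw [← sq_eq_sq₀ (norm_nonneg _) hsin, norm_sub_sq_real, hy, norm_smul, hx, inner_smul_right,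
      real_inner_comm, hcos, mul_one, Real.norm_eq_abs, sq_abs, Real.sin_sq]
    ring
  obtain ⟨v, hv, hxv, hvw⟩ := exists_norm_eq_one_inner_eq_zero_eq_norm_smul hE horth
  refine ⟨v, hv, hxv, θ, ⟨InnerProductGeometry.angle_nonneg x y,
    InnerProductGeometry.angle_le_pi x y⟩, ?_⟩
  rw [← hnorm, ← hvw, add_sub_cancel]

lemma norm_cos_smul_add_sin_smul {x v : E} (hx : ‖x‖ = 1) (hv : ‖v‖ = 1) (hxv : inner ℝ x v = 0)
    (θ : ℝ) : ‖Real.cos θ • x + Real.sin θ • v‖ = 1 := by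
  rw [← sq_eq_sq₀ (norm_nonneg _) zero_le_one, norm_add_sq_real, norm_smul, norm_smul, hx, hv,
    inner_smul_left, inner_smul_right, hxv]
  simp

lemma norm_sub_cos_smul_add_sin_smul_sq {x v : E} (hx : ‖x‖ = 1) (hv : ‖v‖ = 1)
    (hxv : inner ℝ x v = 0) (θ : ℝ) :
    ‖x - (Real.cos θ • x + Real.sin θ • v)‖ ^ 2 = 2 - 2 * Real.cos θ := by
  rw [norm_sub_sq_real, norm_cos_smul_add_sin_smul hx hv hxv, inner_add_right, inner_smul_right,
    inner_smul_right, real_inner_self_eq_norm_sq, hx, hxv]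
  ring

lemma exists_halfCircle (hE : 1 < Module.rank ℝ E) (x y : sphere (0 : E) 1) :
    ∃ g : ℝ → sphere (0 : E) 1, Continuous g ∧ g 0 = x ∧ dist x (g Real.pi) = 2 ∧
      MonotoneOn (fun θ => dist x (g θ)) (Icc 0 Real.pi) ∧ ∃ θ ∈ Icc 0 Real.pi, g θ = y := by
  have hx : ‖x.1‖ = 1 := norm_eq_of_mem_sphere x
  obtain ⟨v, hv, hxv, θ₀, hθ₀, hy⟩ :=
    exists_eq_cos_smul_add_sin_smul hE hx (norm_eq_of_mem_sphere y)
  set g : ℝ → sphere (0 : E) 1 := fun θ => ⟨Real.cos θ • x.1 + Real.sin θ • v,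
    mem_sphere_zero_iff_norm.2 (norm_cos_smul_add_sin_smul hx hv hxv θ)⟩
  have hdist (θ : ℝ) : dist x (g θ) ^ 2 = 2 - 2 * Real.cos θ := by
    rw [Subtype.dist_eq, dist_eq_norm, norm_sub_cos_smul_add_sin_smul_sq hx hv hxv]
  refine ⟨g, Continuous.subtype_mk (by fun_prop) _, Subtype.ext (by simp [g]), ?_, ?_,
    θ₀, hθ₀, Subtype.ext hy.symm⟩
  · rw [← sq_eq_sq₀ dist_nonneg zero_le_two, hdist, Real.cos_pi]
    norm_num
  · intro θ hθ θ' hθ' hle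
    have hcos := Real.cos_le_cos_of_nonneg_of_le_pi hθ.1 hθ'.2 hle
    exact (sq_le_sq₀ dist_nonneg dist_nonneg).1 (by rw [hdist, hdist]; linarith)

lemma exists_isPreconnected_subset_closedBall_of_sphere (hE : 1 < Module.rank ℝ E)
    (x y : sphere (0 : E) 1) :
    ∃ K ⊆ closedBall x (dist x y), IsPreconnected K ∧ x ∈ K ∧ y ∈ K := by
  obtain ⟨g, hg, h0, -, hmono, θ, hθ, rfl⟩ := exists_halfCircle hE x y
  refine ⟨g '' Icc 0 θ, ?_, isPreconnected_Icc.image g hg.continuousOn,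
    ⟨0, left_mem_Icc.2 hθ.1, h0⟩, mem_image_of_mem g (right_mem_Icc.2 hθ.1)⟩
  rintro _ ⟨t, ht, rfl⟩
  exact mem_closedBall'.2 (hmono ⟨ht.1, ht.2.trans hθ.2⟩ hθ ht.2)

lemma ediam_le_ediam_frontier_of_sphere (hE : 1 < Module.rank ℝ E) {A : Set (sphere (0 : E) 1)}
    (hA : ediam A < 1) : ediam A ≤ ediam (frontier A) := by
  refine ediam_le_ediam_frontier (fun x y _ => ?_) hA
  obtain ⟨g, hg, -, hpi, hmono, θ, hθ, rfl⟩ := exists_halfCircle hE x y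
  refine ⟨g '' Icc θ Real.pi, isPreconnected_Icc.image g hg.continuousOn,
    mem_image_of_mem g (left_mem_Icc.2 hθ.2), ?_, g Real.pi,
    mem_image_of_mem g (right_mem_Icc.2 hθ.2), ?_⟩
  · rintro _ ⟨t, ht, rfl⟩
    rw [edist_dist, edist_dist]
    exact ENNReal.ofReal_le_ofReal (hmono hθ ⟨hθ.1.trans ht.1, ht.2⟩ ht.1)
  · rw [edist_dist, hpi]
    simp

end FrontierDiameter

section UnitBox

open Metric

lemma ncard_abs_sub_le (n N : ℕ) (a : ℝ) : {m : Fin n | |(m : ℝ) - a| ≤ N}.ncard ≤ 2 * N + 1 := by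
  have hmap : ∀ m ∈ {m : Fin n | |(m : ℝ) - a| ≤ N},
      ((m : ℕ) : ℤ) ∈ (Finset.Icc ⌈a - N⌉ ⌊a + N⌋ : Set ℤ) := by
    intro m hm
    rw [mem_ofPred_eq, abs_le] at hm
    simp only [Finset.coe_Icc, mem_Icc, Int.ceil_le, Int.le_floor, Int.cast_natCast]
    constructor <;> linarith
  have hinj : Function.Injective fun m : Fin n => ((m : ℕ) : ℤ) :=
    Nat.cast_injective.comp Fin.val_injective
  calc _ ≤ (Finset.Icc ⌈a - N⌉ ⌊a + N⌋ : Set ℤ).ncard :=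
        ncard_le_ncard_of_injOn _ hmap hinj.injOn (Finset.finite_toSet _)
    _ ≤ 2 * N + 1 := by
        rw [ncard_coe_finset, Int.card_Icc, Int.ceil_sub_natCast, Int.floor_add_natCast]
        have := Int.floor_le_ceil a
        omega

lemma ncard_forall_abs_sub_le {ι : Type*} [Fintype ι] (n N : ℕ) (a : ι → ℝ) :
    {m : ι → Fin n | ∀ i, |(m i : ℝ) - a i| ≤ N}.ncard ≤ (2 * N + 1) ^ Fintype.card ι := by
  have hpi : {m : ι → Fin n | ∀ i, |(m i : ℝ) - a i| ≤ N} =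
      univ.pi fun i => {m : Fin n | |(m : ℝ) - a i| ≤ N} := by
    ext m
    exact mem_univ_pi.symm
  have hprod : {m : ι → Fin n | ∀ i, |(m i : ℝ) - a i| ≤ N}.ncard =
      ∏ i, {m : Fin n | |(m : ℝ) - a i| ≤ N}.ncard := by
    rw [hpi, ncard, encard_pi_eq_prod_encard, ENat.toNat_prod]
    rfl
  exact hprod.trans_le (Finset.prod_le_pow_card _ _ _ fun i _ => ncard_abs_sub_le n N (a i))

/-- The unit cube `[0, 1]^ι` with the supremum metric, the model space for the charts of a
dyadically decomposed surface. -/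
abbrev UnitBox (ι : Type) : Type :=
  Icc (0 : ι → ℝ) 1

/-- The closed dyadic cube `∏ i, [mᵢ / 2ᵏ, (mᵢ + 1) / 2ᵏ]` of generation `k`. -/
def unitDyadicCube {ι : Type} (k : ℕ) (m : ι → Fin (2 ^ k)) : Set (UnitBox ι) :=
  {s | ∀ i, s.1 i ∈ Icc (((m i : ℕ) : ℝ) / 2 ^ k) ((((m i : ℕ) : ℝ) + 1) / 2 ^ k)}

lemma nonempty_unitDyadicCube {ι : Type} (k : ℕ) (m : ι → Fin (2 ^ k)) :
    (unitDyadicCube k m).Nonempty := by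
  have h2 : (0 : ℝ) < 2 ^ k := by positivity
  refine ⟨⟨fun i => ((m i : ℕ) : ℝ) / 2 ^ k, fun i => by positivity, fun i => ?_⟩,
    fun i => ⟨le_rfl, by dsimp only; gcongr; linarith⟩⟩
  exact (div_le_one h2).2 (by exact_mod_cast (m i).isLt.le)

lemma Icc_div_two_pow_subset (k : ℕ) (m : Fin (2 ^ k)) :
    Icc (((m : ℕ) : ℝ) / 2 ^ k) ((((m : ℕ) : ℝ) + 1) / 2 ^ k) ⊆ Icc 0 1 :=
  Icc_subset_Icc (by positivity)
    ((div_le_one (by positivity)).2 (by exact_mod_cast Nat.succ_le_of_lt m.isLt))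

lemma exists_mem_Icc_div_two_pow (k : ℕ) {t : ℝ} (ht : t ∈ Icc (0 : ℝ) 1) :
    ∃ m : Fin (2 ^ k), t ∈ Icc (((m : ℕ) : ℝ) / 2 ^ k) ((((m : ℕ) : ℝ) + 1) / 2 ^ k) := by
  have h2 : (0 : ℝ) < 2 ^ k := by positivity
  have h0 : 0 ≤ t * 2 ^ k := mul_nonneg ht.1 h2.le
  simp only [mem_Icc, div_le_iff₀ h2, le_div_iff₀ h2]
  rcases ht.2.eq_or_lt with rfl | h1
  · refine ⟨⟨2 ^ k - 1, Nat.sub_lt (Nat.two_pow_pos k) one_pos⟩, ?_⟩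
    rw [one_mul, Nat.cast_pred (Nat.two_pow_pos k), Nat.cast_pow, Nat.cast_ofNat]
    constructor <;> linarith
  · refine ⟨⟨⌊t * 2 ^ k⌋₊, (Nat.floor_lt h0).2 ?_⟩, Nat.floor_le h0, (Nat.lt_floor_add_one _).le⟩
    rw [Nat.cast_pow, Nat.cast_ofNat]
    exact mul_lt_of_lt_one_left h2 h1

variable {ι : Type} [Fintype ι]

lemma dist_le_of_mem_unitDyadicCube {k : ℕ} {m : ι → Fin (2 ^ k)} {s t : UnitBox ι}
    (hs : s ∈ unitDyadicCube k m) (ht : t ∈ unitDyadicCube k m) : dist s t ≤ 2⁻¹ ^ k := by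
  refine (dist_pi_le_iff (by positivity)).2 fun i => ?_
  refine (Real.dist_le_of_mem_Icc (hs i) (ht i)).trans_eq ?_
  rw [← sub_div, add_sub_cancel_left, inv_pow, one_div]

lemma exists_ncard_unitDyadicCube_le (A : ℝ) : ∃ M : ℕ, ∀ k (s : UnitBox ι),
    {m | (unitDyadicCube k m ∩ closedBall s (A * 2⁻¹ ^ k)).Nonempty}.ncard ≤ M := by
  obtain ⟨N, hN⟩ := exists_nat_ge (A + 1)
  refine ⟨(2 * N + 1) ^ Fintype.card ι, fun k s => ?_⟩
  refine (ncard_le_ncard ?_ (toFinite _)).trans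
    (ncard_forall_abs_sub_le (2 ^ k) N fun i => s.1 i * 2 ^ k)
  rintro m ⟨t, htm, hts⟩ i
  have h2 : (0 : ℝ) < 2 ^ k := by positivity
  have hclose : |t.1 i * 2 ^ k - s.1 i * 2 ^ k| ≤ A := by
    have h := (dist_le_pi_dist t.1 s.1 i).trans hts
    rwa [Real.dist_eq, inv_pow, ← div_eq_mul_inv, le_div_iff₀ h2, ← abs_of_pos h2, ← abs_mul,
      sub_mul] at h
  have hcell := htm i
  rw [mem_Icc, div_le_iff₀ h2, le_div_iff₀ h2] at hcell
  rw [abs_le] at hclose ⊢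
  constructor <;> linarith [hclose.1, hclose.2, hcell.1, hcell.2]

lemma isDyadicCovering_unitDyadicCube :
    IsDyadicCovering univ fun k (m : ι → Fin (2 ^ k)) => unitDyadicCube k m where
  nonempty := nonempty_unitDyadicCube
  iUnion_eq k := iUnion_eq_univ_iff.2 fun s => by
    choose m hm using fun i => exists_mem_Icc_div_two_pow k ⟨s.2.1 i, s.2.2 i⟩
    exact ⟨m, hm⟩
  exists_dist_le := ⟨1, one_pos, fun k m s hs t ht =>
    (dist_le_of_mem_unitDyadicCube hs ht).trans_eq (one_mul _).symm⟩
  exists_ncard_le := exists_ncard_unitDyadicCube_le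

lemma exists_Icc_subset {p ρ : ℝ} (hp : p ∈ Icc (0 : ℝ) 1) (h0 : 0 ≤ ρ) (h1 : ρ ≤ 2⁻¹) :
    ∃ b, Icc b (b + ρ) ⊆ Icc 0 1 ∩ Icc (p - ρ) (p + ρ) := by
  rcases le_total p 2⁻¹ with hp' | hp'
  · exact ⟨p, fun t ht => ⟨⟨hp.1.trans ht.1, by linarith [ht.2]⟩, by linarith [ht.1], ht.2⟩⟩
  · refine ⟨p - ρ, fun t ht => ?_⟩
    rw [sub_add_cancel] at ht
    exact ⟨⟨by linarith [ht.1], ht.2.trans hp.2⟩, ht.1, by linarith [ht.2]⟩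

end UnitBox

section AhlforsRegular

open Metric

open scoped Measure NNReal

/-- Ahlfors `d`-regularity of the measure `μ` at scales up to `1`. -/
structure IsAhlforsRegular {X : Type*} [PseudoMetricSpace X] [MeasurableSpace X] (μ : Measure X)
    (d : ℝ) : Prop where
  exists_measure_closedBall_le : ∃ C : ℝ≥0∞, C ≠ ⊤ ∧ ∀ x r,
    μ (closedBall x r) ≤ C * ENNReal.ofReal r ^ d
  exists_le_measure_closedBall : ∃ c : ℝ≥0∞, c ≠ 0 ∧ ∀ x, ∀ r ∈ Icc (0 : ℝ) 1,
    c * ENNReal.ofReal r ^ d ≤ μ (closedBall x r)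

lemma hausdorffMeasure_unitBox {ι : Type} [Fintype ι] (A : Set (UnitBox ι)) :
    μH[Fintype.card ι] A = volume ((↑) '' A : Set (ι → ℝ)) := by
  rw [← hausdorffMeasure_pi_real,
    isometry_subtype_coe.hausdorffMeasure_image (Or.inl (Nat.cast_nonneg _))]

lemma isAhlforsRegular_unitBox (ι : Type) [Fintype ι] :
    IsAhlforsRegular (μH[Fintype.card ι] : Measure (UnitBox ι)) (Fintype.card ι) where
  exists_measure_closedBall_le := by
    refine ⟨ENNReal.ofReal 2 ^ Fintype.card ι, by finiteness, fun x r => ?_⟩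
    rcases lt_or_ge r 0 with hr | hr
    · simp [closedBall_eq_empty.2 hr]
    rw [hausdorffMeasure_unitBox, ENNReal.rpow_natCast, ← mul_pow,
      ← ENNReal.ofReal_mul zero_le_two, ← ENNReal.ofReal_pow (by positivity),
      ← Real.volume_pi_closedBall x.1 hr]
    exact measure_mono (image_subset_iff.2 fun _ h => h)
  exists_le_measure_closedBall := by
    refine ⟨ENNReal.ofReal 2⁻¹ ^ Fintype.card ι, by positivity, fun x r hr => ?_⟩
    choose b hb using fun i => exists_Icc_subset ⟨x.2.1 i, x.2.2 i⟩
      (show 0 ≤ 2⁻¹ * r by linarith [hr.1]) (by linarith [hr.2])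
    have hsub : Icc b (fun i => b i + 2⁻¹ * r) ⊆ (↑) '' closedBall x r := fun s hs => by
      have hs' := fun i => hb i ⟨hs.1 i, hs.2 i⟩
      refine ⟨⟨s, fun i => (hs' i).1.1, fun i => (hs' i).1.2⟩, ?_, rfl⟩
      refine (dist_pi_le_iff hr.1).2 fun i => abs_le.2 ?_
      constructor <;> linarith [(hs' i).2.1, (hs' i).2.2, hr.1]
    rw [hausdorffMeasure_unitBox, ENNReal.rpow_natCast, ← mul_pow,
      ← ENNReal.ofReal_mul (by norm_num)]
    refine Eq.trans_le ?_ (measure_mono hsub)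
    simp [Real.volume_Icc_pi]

lemma IsAhlforsRegular.isFiniteMeasure {X : Type*} [PseudoMetricSpace X] [BoundedSpace X]
    [MeasurableSpace X] {μ : Measure X} {d : ℝ} (hd : 0 ≤ d) (hμ : IsAhlforsRegular μ d) :
    IsFiniteMeasure μ := by
  obtain ⟨C, hC, hle⟩ := hμ.exists_measure_closedBall_le
  rcases isEmpty_or_nonempty X with _ | ⟨⟨x⟩⟩
  · infer_instance
  have huniv : univ ⊆ closedBall x (diam (univ : Set X)) := fun y _ =>
    dist_le_diam_of_mem (Bornology.IsBounded.all univ) (mem_univ y) (mem_univ x)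
  exact ⟨((measure_mono huniv).trans (hle x _)).trans_lt (by finiteness)⟩

end AhlforsRegular

section BiLipschitzAtlas

open Metric

open scoped Measure NNReal

/-- A family of uniformly bi-Lipschitz parametrizations `ψ f` whose images cover `Ω` exactly; the
images may overlap. -/
structure IsBiLipschitzAtlas {F Z X : Type*} [PseudoEMetricSpace Z] [PseudoEMetricSpace X]
    (Ω : Set X) (ψ : F → Z → X) : Prop where
  iUnion_range_eq : ⋃ f, range (ψ f) = Ω
  exists_lipschitzWith : ∃ L : ℝ≥0, ∀ f, LipschitzWith L (ψ f)
  exists_antilipschitzWith : ∃ a : ℝ≥0, ∀ f, AntilipschitzWith a (ψ f)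

lemma dist_le_of_mem_preimage_closedBall {Z X : Type*} [PseudoMetricSpace Z] [PseudoMetricSpace X]
    {ψ : Z → X} {a : ℝ≥0} (hψ : AntilipschitzWith a ψ) {x : X} {r : ℝ} {s t : Z}
    (hs : s ∈ ψ ⁻¹' closedBall x r) (ht : t ∈ ψ ⁻¹' closedBall x r) : dist s t ≤ a * 2 * r := by
  calc dist s t ≤ a * dist (ψ s) (ψ t) := hψ.le_mul_dist s t
    _ ≤ a * (r + r) := by
        gcongr
        exact (dist_triangle_right _ _ x).trans (add_le_add hs ht)
    _ = a * 2 * r := by ring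

lemma exists_ncard_image_le_of_antilipschitzWith {Z X : Type*} [MetricSpace Z] [MetricSpace X]
    {κ : ℕ → Type} [∀ k, Finite (κ k)] {Ω : Set Z} {Q : ∀ k, κ k → Set Z}
    (hQ : IsDyadicCovering Ω Q) (a : ℝ≥0) (A : ℝ) :
    ∃ M : ℕ, ∀ ψ : Z → X, AntilipschitzWith a ψ → ∀ k x,
      {j | (ψ '' Q k j ∩ closedBall x (A * 2⁻¹ ^ k)).Nonempty}.ncard ≤ M := by
  obtain ⟨M, hM⟩ := hQ.exists_ncard_le (a * 2 * A)
  refine ⟨M, fun ψ hψ k x => ?_⟩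
  rcases {j | (ψ '' Q k j ∩ closedBall x (A * 2⁻¹ ^ k)).Nonempty}.eq_empty_or_nonempty with h | h
  · rw [h, ncard_empty]
    exact Nat.zero_le M
  obtain ⟨-, -, ⟨s, -, rfl⟩, hs⟩ := h
  refine (ncard_le_ncard ?_ (toFinite _)).trans (hM k s)
  rintro j ⟨-, ⟨t, htj, rfl⟩, ht⟩
  exact ⟨t, htj, (dist_le_of_mem_preimage_closedBall hψ ht hs).trans_eq (mul_assoc _ _ _).symm⟩

variable {F : Type} {Z X : Type*} [MetricSpace Z] [MetricSpace X] {Ω : Set X}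
  {ψ : F → Z → X}

lemma IsBiLipschitzAtlas.isDyadicCovering [Finite F] (hψ : IsBiLipschitzAtlas Ω ψ)
    {κ : ℕ → Type} [∀ k, Finite (κ k)] {Q : ∀ k, κ k → Set Z} (hQ : IsDyadicCovering univ Q) :
    IsDyadicCovering Ω fun k (j : F × κ k) => ψ j.1 '' Q k j.2 where
  nonempty k j := (hQ.nonempty k j.2).image _
  iUnion_eq k := by
    simp_rw [iUnion_prod', ← image_iUnion, hQ.iUnion_eq, image_univ]
    exact hψ.iUnion_range_eq
  exists_dist_le := by
    obtain ⟨L, hL⟩ := hψ.exists_lipschitzWith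
    obtain ⟨D, hD, hdist⟩ := hQ.exists_dist_le
    refine ⟨(L + 1) * D, by positivity, ?_⟩
    rintro k ⟨f, m⟩ _ ⟨s, hs, rfl⟩ _ ⟨t, ht, rfl⟩
    calc dist (ψ f s) (ψ f t) ≤ L * dist s t := (hL f).dist_le_mul s t
      _ ≤ (L + 1) * (D * 2⁻¹ ^ k) := by
          gcongr
          · exact le_add_of_nonneg_right zero_le_one
          · exact hdist k m s hs t ht
      _ = (L + 1) * D * 2⁻¹ ^ k := (mul_assoc _ _ _).symm
  exists_ncard_le A := by
    have := Fintype.ofFinite F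
    obtain ⟨a, ha⟩ := hψ.exists_antilipschitzWith
    obtain ⟨M, hM⟩ := exists_ncard_image_le_of_antilipschitzWith (X := X) hQ a A
    refine ⟨∑ _f : F, M, fun k x => ?_⟩
    have hsub : {j : F × κ k | (ψ j.1 '' Q k j.2 ∩ closedBall x (A * 2⁻¹ ^ k)).Nonempty} ⊆
        ⋃ f, Prod.mk f '' {m | (ψ f '' Q k m ∩ closedBall x (A * 2⁻¹ ^ k)).Nonempty} :=
      fun j hj => mem_iUnion.2 ⟨j.1, j.2, hj, rfl⟩
    calc _ ≤ _ := ncard_le_ncard hsub (toFinite _)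
      _ ≤ _ := ncard_iUnion_le_of_fintype _
      _ ≤ ∑ _f : F, M := Finset.sum_le_sum fun f _ =>
          (ncard_image_le (toFinite _)).trans (hM (ψ f) (ha f) k x)

lemma IsBiLipschitzAtlas.comp {X' : Type*} [MetricSpace X'] (hψ : IsBiLipschitzAtlas Ω ψ)
    {Φ : X → X'} {L a : ℝ≥0} (hL : LipschitzWith L Φ) (ha : AntilipschitzWith a Φ) :
    IsBiLipschitzAtlas (Φ '' Ω) fun f => Φ ∘ ψ f where
  iUnion_range_eq := by simp_rw [range_comp, ← image_iUnion, hψ.iUnion_range_eq]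
  exists_lipschitzWith := by
    obtain ⟨L', hL'⟩ := hψ.exists_lipschitzWith
    exact ⟨_, fun f => hL.comp (hL' f)⟩
  exists_antilipschitzWith := by
    obtain ⟨a', ha'⟩ := hψ.exists_antilipschitzWith
    exact ⟨_, fun f => ha.comp (ha' f)⟩

lemma IsBiLipschitzAtlas.exists_subtype (hψ : IsBiLipschitzAtlas Ω ψ) :
    ∃ χ : F → Z → Ω, (∀ f, Subtype.val ∘ χ f = ψ f) ∧ IsBiLipschitzAtlas univ χ := by
  have hmem : ∀ f s, ψ f s ∈ Ω := fun f s =>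
    hψ.iUnion_range_eq ▸ mem_iUnion_of_mem f (mem_range_self s)
  refine ⟨fun f s => ⟨ψ f s, hmem f s⟩, fun f => rfl, iUnion_eq_univ_iff.2 fun x => ?_,
    hψ.exists_lipschitzWith, hψ.exists_antilipschitzWith⟩
  obtain ⟨f, s, hs⟩ := mem_iUnion.1 (hψ.iUnion_range_eq.superset x.2)
  exact ⟨f, s, Subtype.ext hs⟩

variable [MeasurableSpace Z] [BorelSpace Z] [MeasurableSpace X] [BorelSpace X] {d : ℝ}

lemma IsBiLipschitzAtlas.exists_hausdorffMeasure_closedBall_le [Finite F]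
    (hψ : IsBiLipschitzAtlas univ ψ) (hd : 0 ≤ d)
    (hZ : IsAhlforsRegular (μH[d] : Measure Z) d) :
    ∃ C : ℝ≥0∞, C ≠ ⊤ ∧ ∀ (x : X) r, μH[d] (closedBall x r) ≤ C * ENNReal.ofReal r ^ d := by
  have := Fintype.ofFinite F
  obtain ⟨L, hL⟩ := hψ.exists_lipschitzWith
  obtain ⟨a, ha⟩ := hψ.exists_antilipschitzWith
  obtain ⟨C, hC, hball⟩ := hZ.exists_measure_closedBall_le
  refine ⟨∑ _f : F, (L : ℝ≥0∞) ^ d * (C * ENNReal.ofReal (a * 2) ^ d),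
    ENNReal.sum_ne_top.2 fun _ _ => by finiteness, fun x r => ?_⟩
  have hpre : ∀ f, μH[d] (ψ f ⁻¹' closedBall x r) ≤
      C * ENNReal.ofReal (a * 2) ^ d * ENNReal.ofReal r ^ d := fun f => by
    rcases (ψ f ⁻¹' closedBall x r).eq_empty_or_nonempty with h | ⟨s, hs⟩
    · rw [h, measure_empty]
      exact zero_le
    rw [mul_assoc, ← ENNReal.mul_rpow_of_nonneg _ _ hd, ← ENNReal.ofReal_mul (by positivity)]
    exact (measure_mono fun t ht => dist_le_of_mem_preimage_closedBall (ha f) ht hs).trans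
      (hball s _)
  have hcover : closedBall x r ⊆ ⋃ f, ψ f '' (ψ f ⁻¹' closedBall x r) := by
    simp_rw [image_preimage_eq_inter_range, ← inter_iUnion, hψ.iUnion_range_eq, inter_univ]
    exact subset_rfl
  calc μH[d] (closedBall x r) ≤ ∑ f, μH[d] (ψ f '' (ψ f ⁻¹' closedBall x r)) :=
        (measure_mono hcover).trans (measure_iUnion_fintype_le _ _)
    _ ≤ ∑ _f : F, (L : ℝ≥0∞) ^ d * (C * ENNReal.ofReal (a * 2) ^ d * ENNReal.ofReal r ^ d) := by
        gcongr with f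
        exact ((hL f).hausdorffMeasure_image_le hd _).trans (by gcongr; exact hpre f)
    _ = _ := by simp_rw [Finset.sum_mul, mul_assoc]

lemma IsBiLipschitzAtlas.exists_le_hausdorffMeasure_closedBall (hψ : IsBiLipschitzAtlas univ ψ)
    (hd : 0 ≤ d) (hZ : IsAhlforsRegular (μH[d] : Measure Z) d) :
    ∃ c : ℝ≥0∞, c ≠ 0 ∧ ∀ x : X, ∀ r ∈ Icc (0 : ℝ) 1,
      c * ENNReal.ofReal r ^ d ≤ μH[d] (closedBall x r) := by
  obtain ⟨L, hL⟩ := hψ.exists_lipschitzWith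
  obtain ⟨a, ha⟩ := hψ.exists_antilipschitzWith
  obtain ⟨c, hc, hball⟩ := hZ.exists_le_measure_closedBall
  set b : ℝ := (L + 1 : ℝ)⁻¹
  have hb0 : 0 < b := by positivity
  have hb1 : b ≤ 1 := inv_le_one_of_one_le₀ (by simp)
  have hLb : L * b ≤ 1 := by
    rw [← div_eq_mul_inv, div_le_one (by positivity)]
    exact le_add_of_nonneg_right zero_le_one
  refine ⟨((a : ℝ≥0∞) ^ d)⁻¹ * (c * ENNReal.ofReal b ^ d), ?_, fun x r hr => ?_⟩
  · have hbd : 0 < ENNReal.ofReal b ^ d := ENNReal.rpow_pos (by simpa) ENNReal.ofReal_ne_top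
    exact mul_ne_zero (ENNReal.inv_ne_zero.2 (by finiteness)) (mul_ne_zero hc hbd.ne')
  obtain ⟨f, s, rfl⟩ : ∃ f, x ∈ range (ψ f) := iUnion_eq_univ_iff.1 hψ.iUnion_range_eq x
  have himage : ψ f '' closedBall s (b * r) ⊆ closedBall (ψ f s) r := by
    rw [image_subset_iff]
    intro t ht
    calc dist (ψ f t) (ψ f s) ≤ L * dist t s := (hL f).dist_le_mul t s
      _ ≤ L * (b * r) := by gcongr; exact ht
      _ = L * b * r := (mul_assoc _ _ _).symm
      _ ≤ r := mul_le_of_le_one_left hr.1 hLb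
  have hZball : c * ENNReal.ofReal b ^ d * ENNReal.ofReal r ^ d ≤
      (a : ℝ≥0∞) ^ d * μH[d] (closedBall (ψ f s) r) := by
    rw [mul_assoc, ← ENNReal.mul_rpow_of_nonneg _ _ hd, ← ENNReal.ofReal_mul hb0.le]
    calc _ ≤ μH[d] (closedBall s (b * r)) :=
          hball s _ ⟨mul_nonneg hb0.le hr.1, mul_le_one₀ hb1 hr.1 hr.2⟩
      _ ≤ (a : ℝ≥0∞) ^ d * μH[d] (ψ f '' closedBall s (b * r)) :=
          (ha f).le_hausdorffMeasure_image hd _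
      _ ≤ _ := by gcongr
  rw [mul_assoc, mul_comm, ← div_eq_mul_inv]
  exact ENNReal.div_le_of_le_mul' hZball

lemma IsBiLipschitzAtlas.isAhlforsRegular [Finite F] (hψ : IsBiLipschitzAtlas univ ψ)
    (hd : 0 ≤ d) (hZ : IsAhlforsRegular (μH[d] : Measure Z) d) :
    IsAhlforsRegular (μH[d] : Measure X) d :=
  ⟨hψ.exists_hausdorffMeasure_closedBall_le hd hZ, hψ.exists_le_hausdorffMeasure_closedBall hd hZ⟩

end BiLipschitzAtlas

lemma gagliardoEnergy_mono {X Y : Type*} [MetricSpace X] [MeasurableSpace X] [MetricSpace Y]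
    {μ ν : Measure X} (h : μ ≤ ν) (q : ℝ) (φ : X → Y) :
    gagliardoEnergy μ q φ ≤ gagliardoEnergy ν q φ :=
  lintegral_mono' h fun _ => lintegral_mono' h le_rfl

section Plane

open Metric

lemma convex_planeSquare (R : ℝ) : Convex ℝ (planeSquare R) := fun _ hx _ hy _ _ ha hb hab i =>
  convex_Icc (-R) R (hx i) (hy i) ha hb hab

lemma isCompact_planeSquare (R : ℝ) : IsCompact (planeSquare R) := by
  have hpi : planeSquare R = (EuclideanSpace.equiv (Fin 2) ℝ).toHomeomorph ⁻¹'
      (univ.pi fun _ => Icc (-R) R) := by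
    ext x
    exact mem_univ_pi.symm
  rw [hpi, Homeomorph.isCompact_preimage]
  exact isCompact_univ_pi fun _ => isCompact_Icc

lemma planeSquare_mono {R R' : ℝ} (h : R ≤ R') : planeSquare R ⊆ planeSquare R' :=
  fun _ hx i => Icc_subset_Icc (neg_le_neg h) h (hx i)

lemma closedBall_subset_planeSquare {R r : ℝ} {x : EuclideanSpace ℝ (Fin 2)}
    (hx : x ∈ planeSquare R) : closedBall x r ⊆ planeSquare (R + r) := by
  intro y hy i
  have hyx : |y i - x i| ≤ r :=
    (PiLp.norm_apply_le (y - x) i).trans ((dist_eq_norm y x).ge.trans hy)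
  rw [abs_le] at hyx
  constructor <;> linarith [(hx i).1, (hx i).2, hyx.1, hyx.2]

/-- The affine chart from `[0, 1]²` onto `[-R, R]²`. -/
def planeChart (R : ℝ) (s : UnitBox (Fin 2)) : EuclideanSpace ℝ (Fin 2) :=
  WithLp.toLp 2 ((fun _ => -R) + (2 * R) • s.1)

lemma exists_planeChart_eq {R : ℝ} (hR : 0 < R) {a b : Fin 2 → ℝ}
    (hab : ∀ i, Icc (a i) (b i) ⊆ Icc 0 1) {x : EuclideanSpace ℝ (Fin 2)}
    (hx : ∀ i, x i ∈ Icc (-R + 2 * R * a i) (-R + 2 * R * b i)) :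
    ∃ s : UnitBox (Fin 2), (∀ i, s.1 i ∈ Icc (a i) (b i)) ∧ planeChart R s = x := by
  have h2R : 0 < 2 * R := by positivity
  have hmem : ∀ i, (x i + R) / (2 * R) ∈ Icc (a i) (b i) := fun i => by
    rw [mem_Icc, le_div_iff₀' h2R, div_le_iff₀' h2R]
    constructor <;> linarith [(hx i).1, (hx i).2]
  refine ⟨⟨fun i => (x i + R) / (2 * R), fun i => (hab i (hmem i)).1,
    fun i => (hab i (hmem i)).2⟩, hmem, ?_⟩
  ext i
  change -R + 2 * R * ((x i + R) / (2 * R)) = x i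
  rw [mul_div_cancel₀ _ h2R.ne', neg_add_cancel_comm_assoc]

lemma planeChart_mem_Icc {R : ℝ} (hR : 0 ≤ R) {s : UnitBox (Fin 2)} {i : Fin 2} {a b : ℝ}
    (hs : s.1 i ∈ Icc a b) : planeChart R s i ∈ Icc (-R + 2 * R * a) (-R + 2 * R * b) := by
  change -R + 2 * R * s.1 i ∈ _
  exact ⟨by gcongr; exact hs.1, by gcongr; exact hs.2⟩

lemma range_planeChart {R : ℝ} (hR : 0 < R) : range (planeChart R) = planeSquare R := by
  have hIcc : Icc (-R + 2 * R * 0) (-R + 2 * R * 1) = Icc (-R) R := by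
    congr 1 <;> ring
  refine subset_antisymm ?_ fun x hx => ?_
  · rintro _ ⟨s, rfl⟩ i
    exact hIcc.subset (planeChart_mem_Icc hR.le ⟨s.2.1 i, s.2.2 i⟩)
  · obtain ⟨s, -, rfl⟩ := exists_planeChart_eq hR (fun _ => Subset.rfl) fun i =>
      hIcc.superset (hx i)
    exact mem_range_self s

lemma planeDyadicSquare_eq_image {R : ℝ} (hR : 0 < R) (k : ℕ) (m : Fin 2 → Fin (2 ^ k)) :
    planeDyadicSquare R k m = planeChart R '' unitDyadicCube k m := by
  refine subset_antisymm (fun x hx => ?_) ?_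
  · exact exists_planeChart_eq hR (fun i => Icc_div_two_pow_subset k (m i)) hx
  · rintro _ ⟨s, hs, rfl⟩ i
    exact planeChart_mem_Icc hR.le (hs i)

lemma isBiLipschitzAtlas_planeChart {R : ℝ} (hR : 0 < R) :
    IsBiLipschitzAtlas (planeSquare R) fun _ : Unit => planeChart R where
  iUnion_range_eq := (iUnion_const _).trans (range_planeChart hR)
  exists_lipschitzWith :=
    ⟨_, fun _ => (PiLp.lipschitzWith_toLp 2 _).comp <|
      LipschitzWith.of_dist_le_mul (K := ‖2 * R‖₊) fun s t => by
        rw [dist_add_left, dist_smul₀, coe_nnnorm, Subtype.dist_eq]⟩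
  exists_antilipschitzWith :=
    ⟨_, fun _ => (PiLp.antilipschitzWith_toLp 2 _).comp <|
      AntilipschitzWith.of_le_mul_dist (K := ‖2 * R‖₊⁻¹) fun s t => by
        rw [dist_add_left, dist_smul₀, NNReal.coe_inv, coe_nnnorm, Subtype.dist_eq,
          inv_mul_cancel_left₀ (by simpa using hR.ne')]⟩

lemma isDyadicCovering_planeDyadicSquare {R : ℝ} (hR : 0 < R) :
    IsDyadicCovering (planeSquare R) (planeDyadicSquare R) := by
  have hQ := ((isBiLipschitzAtlas_planeChart hR).isDyadicCovering
    isDyadicCovering_unitDyadicCube).comp_equiv fun k => (Equiv.punitProd _).symm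
  convert hQ using 3 with k m
  exact planeDyadicSquare_eq_image hR k m

lemma gagliardoEnergy_planeSquare_lt_top {R q : ℝ} (hR : 0 < R) (hq : 0 < q)
    {Y : Type*} [MetricSpace Y] {φ : EuclideanSpace ℝ (Fin 2) → Y} (hφ : Continuous φ)
    (h : diameterSum (planeDyadicSquare R) q φ < ⊤) :
    gagliardoEnergy (volume.restrict (planeSquare R)) q φ < ⊤ := by
  have hc := isCompact_planeSquare R
  have : IsFiniteMeasure (volume.restrict (planeSquare R)) :=
    isFiniteMeasure_restrict.2 hc.measure_ne_top
  have hball (x : EuclideanSpace ℝ (Fin 2)) (r : ℝ) : volume.restrict (planeSquare R)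
      (closedBall x r) ≤ ENNReal.ofReal Real.pi * ENNReal.ofReal r ^ 2 := by
    refine (Measure.restrict_apply_le _ _).trans_eq ?_
    rw [EuclideanSpace.volume_closedBall_fin_two, mul_comm]
  have hconn : ∀ x ∈ planeSquare R, ∀ y ∈ planeSquare R, ∃ K ⊆ planeSquare R ∩
      closedBall x (dist x y), IsPreconnected K ∧ x ∈ K ∧ y ∈ K := fun x hx y hy =>
    ⟨segment ℝ x y, ((convex_planeSquare R).inter (convex_closedBall x _)).segment_subset
      ⟨hx, mem_closedBall_self dist_nonneg⟩ ⟨hy, mem_closedBall'.2 le_rfl⟩,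
      (convex_segment x y).isPreconnected, left_mem_segment ℝ x y, right_mem_segment ℝ x y⟩
  exact gagliardoEnergy_lt_top_of_diameterSum_lt_top (ae_restrict_mem hc.measurableSet)
    ENNReal.ofReal_ne_top hball (isDyadicCovering_planeDyadicSquare hR) hconn hq hφ
    (hc.image hφ).isBounded.ediam_ne_top h

lemma diameterSum_planeDyadicSquare_lt_top {R q : ℝ} (hR : 0 < R) (hq : 2 < q)
    {E : Type*} [NormedAddCommGroup E] [NormedSpace ℝ E]
    (φ : EuclideanSpace ℝ (Fin 2) ≃ₜ E)
    (h : gagliardoEnergy (volume.restrict (planeSquare (R + 1))) q φ < ⊤) :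
    diameterSum (planeDyadicSquare R) q φ < ⊤ := by
  have : IsFiniteMeasure (volume.restrict (planeSquare (R + 1))) :=
    isFiniteMeasure_restrict.2 (isCompact_planeSquare _).measure_ne_top
  have hlow : ∀ x ∈ planeSquare R, ∀ y ∈ closedBall x 2⁻¹, ∀ s ≤ 2⁻¹,
      ENNReal.ofReal Real.pi * ENNReal.ofReal s ^ 2 ≤
        volume.restrict (planeSquare (R + 1)) (closedBall y s) := fun x hx y hy s hs => by
    have hsub : closedBall y s ⊆ planeSquare (R + 1) :=
      (closedBall_subset_closedBall' (by linarith [mem_closedBall.1 hy])).trans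
        (closedBall_subset_planeSquare hx)
    rw [Measure.restrict_eq_self _ hsub, EuclideanSpace.volume_closedBall_fin_two, mul_comm]
  exact diameterSum_lt_top_of_gagliardoEnergy_lt_top (isCompact_planeSquare R)
    (isDyadicCovering_planeDyadicSquare hR) (ENNReal.ofReal_pos.2 Real.pi_pos).ne' (by norm_num)
    hlow one_pos (fun _ => ediam_le_ediam_frontier_of_normedSpace) hq φ h

theorem gagliardoEnergy_plane_iff {q : ℝ} (hq : 2 < q) {E : Type*} [NormedAddCommGroup E]
    [NormedSpace ℝ E] (φ : EuclideanSpace ℝ (Fin 2) ≃ₜ E) :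
    (∀ R : ℝ, 0 < R → gagliardoEnergy (volume.restrict (planeSquare R)) q φ < ⊤) ↔
      ∀ N : ℕ, 1 ≤ N → diameterSum (planeDyadicSquare (N : ℝ)) q φ < ⊤ := by
  refine ⟨fun h N hN => ?_, fun h R hR => ?_⟩
  · exact diameterSum_planeDyadicSquare_lt_top (Nat.cast_pos.2 hN) hq φ (h _ (by positivity))
  · obtain ⟨N, hN⟩ := exists_nat_ge R
    have hN0 : (0 : ℝ) < N := hR.trans_le hN
    exact (gagliardoEnergy_mono (Measure.restrict_mono (planeSquare_mono hN) le_rfl) q φ).trans_lt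
      (gagliardoEnergy_planeSquare_lt_top hN0 (by linarith) φ.continuous
        (h N (Nat.cast_pos.1 hN0)))

end Plane

section Sphere

open Metric

open scoped Measure NNReal

lemma IsBiLipschitz.exists_lipschitzWith {X Y : Type*} [MetricSpace X] [MetricSpace Y] {Φ : X → Y}
    (hΦ : IsBiLipschitz Φ) : ∃ L : ℝ≥0, LipschitzWith L Φ := by
  obtain ⟨-, c, C, -, hC, h⟩ := hΦ
  exact ⟨⟨C, hC.le⟩, LipschitzWith.of_dist_le_mul fun x y => (h x y).2⟩

lemma IsBiLipschitz.exists_antilipschitzWith {X Y : Type*} [MetricSpace X] [MetricSpace Y]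
    {Φ : X → Y} (hΦ : IsBiLipschitz Φ) : ∃ a : ℝ≥0, AntilipschitzWith a Φ := by
  obtain ⟨-, c, C, hc, -, h⟩ := hΦ
  exact ⟨⟨c⁻¹, (inv_pos.2 hc).le⟩, AntilipschitzWith.of_le_mul_dist fun x y =>
    (le_inv_mul_iff₀ hc).2 (h x y).1⟩

lemma IsBiLipschitz.isHomeomorph {X Y : Type*} [MetricSpace X] [MetricSpace Y] {Φ : X → Y}
    (hΦ : IsBiLipschitz Φ) : IsHomeomorph Φ := by
  obtain ⟨L, hL⟩ := hΦ.exists_lipschitzWith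
  obtain ⟨a, ha⟩ := hΦ.exists_antilipschitzWith
  exact isHomeomorph_iff_isEmbedding_surjective.2
    ⟨(ha.isUniformEmbedding hL.uniformContinuous).isEmbedding, hΦ.1.2⟩

/-- The parametrization by `[0, 1]²` of the face `x i = e` of the unit cube, where `f = (i, e)`. -/
def facePoint (f : Fin 3 × Fin 2) (s : UnitBox (Fin 2)) : EuclideanSpace ℝ (Fin 3) :=
  WithLp.toLp 2 (f.1.insertNth (α := fun _ => ℝ) (f.2 : ℕ) s.1)

lemma facePoint_apply_self (f : Fin 3 × Fin 2) (s : UnitBox (Fin 2)) :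
    facePoint f s f.1 = (f.2 : ℕ) :=
  Fin.insertNth_apply_same (α := fun _ => ℝ) _ _ _

lemma facePoint_apply_succAbove (f : Fin 3 × Fin 2) (s : UnitBox (Fin 2)) (l : Fin 2) :
    facePoint f s (f.1.succAbove l) = s.1 l :=
  Fin.insertNth_apply_succAbove (α := fun _ => ℝ) _ _ _ _

lemma exists_facePoint_eq {f : Fin 3 × Fin 2} {x : EuclideanSpace ℝ (Fin 3)}
    (hf : x f.1 = (f.2 : ℕ)) (hx : ∀ l, x (f.1.succAbove l) ∈ Icc (0 : ℝ) 1) :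
    ∃ s, facePoint f s = x := by
  refine ⟨⟨fun l => x (f.1.succAbove l), fun l => (hx l).1, fun l => (hx l).2⟩, ?_⟩
  ext i
  cases i using f.1.succAboveCases with
  | x => rw [facePoint_apply_self, hf]
  | p l => rw [facePoint_apply_succAbove]

lemma mem_frontier_unitCube_iff {x : EuclideanSpace ℝ (Fin 3)} :
    x ∈ frontier unitCube ↔ x ∈ unitCube ∧ ∃ i, x i = 0 ∨ x i = 1 := by
  have hpi : unitCube = (EuclideanSpace.equiv (Fin 3) ℝ).toHomeomorph ⁻¹'
      (univ.pi fun _ => Icc (0 : ℝ) 1) := by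
    ext x
    exact mem_univ_pi.symm
  have hint : x ∈ interior unitCube ↔ ∀ i, x i ∈ Ioo (0 : ℝ) 1 := by
    rw [hpi, ← Homeomorph.preimage_interior, interior_pi_set finite_univ]
    simp only [interior_Icc]
    exact mem_univ_pi
  have hclosed : IsClosed unitCube := by
    rw [hpi, Homeomorph.isClosed_preimage]
    exact isClosed_set_pi fun _ _ => isClosed_Icc
  rw [hclosed.frontier_eq, mem_sdiff, hint, not_forall]
  refine and_congr_right fun hx => exists_congr fun i => ?_
  rw [mem_Ioo, not_and_or, not_lt, not_lt, (hx i).1.ge_iff_eq', (hx i).2.ge_iff_eq]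

lemma isBiLipschitzAtlas_facePoint : IsBiLipschitzAtlas (frontier unitCube) facePoint where
  iUnion_range_eq := by
    ext x
    rw [mem_iUnion, mem_frontier_unitCube_iff]
    constructor
    · rintro ⟨f, s, rfl⟩
      have hf : ((f.2 : ℕ) : ℝ) = 0 ∨ ((f.2 : ℕ) : ℝ) = 1 := by
        obtain ⟨i, e⟩ := f
        fin_cases e <;> simp
      refine ⟨(Fin.forall_iff_succAbove f.1).2 ⟨?_, fun l => ?_⟩, f.1, ?_⟩
      · rw [facePoint_apply_self]
        rcases hf with hf | hf <;> simp [hf]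
      · rw [facePoint_apply_succAbove]
        exact ⟨s.2.1 l, s.2.2 l⟩
      · rwa [facePoint_apply_self]
    · rintro ⟨hx, i, hi | hi⟩
      · exact ⟨(i, 0), exists_facePoint_eq (by simpa using hi) fun l => hx _⟩
      · exact ⟨(i, 1), exists_facePoint_eq (by simpa using hi) fun l => hx _⟩
  exists_lipschitzWith :=
    ⟨_, fun f => (PiLp.lipschitzWith_toLp 2 _).comp <|
      LipschitzWith.of_dist_le_mul (K := 1) fun s t => by
        rw [Fin.dist_insertNth_insertNth, dist_self, Subtype.dist_eq]
        simp⟩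
  exists_antilipschitzWith :=
    ⟨_, fun f => (PiLp.antilipschitzWith_toLp 2 _).comp <|
      AntilipschitzWith.of_le_mul_dist (K := 1) fun s t => by
        rw [Fin.dist_insertNth_insertNth, dist_self, Subtype.dist_eq]
        simp⟩

lemma cubeDyadicSquare_eq_image (k : ℕ) (j : Fin 3 × Fin 2 × (Fin 2 → Fin (2 ^ k))) :
    cubeDyadicSquare k j = facePoint (j.1, j.2.1) '' unitDyadicCube k j.2.2 := by
  refine subset_antisymm ?_ ?_
  · rintro x ⟨hf, hx⟩
    obtain ⟨s, rfl⟩ := exists_facePoint_eq (f := (j.1, j.2.1)) hf fun l =>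
      Icc_div_two_pow_subset k (j.2.2 l) (hx l)
    refine ⟨s, fun l => ?_, rfl⟩
    rw [← facePoint_apply_succAbove (j.1, j.2.1)]
    exact hx l
  · rintro _ ⟨s, hs, rfl⟩
    refine ⟨facePoint_apply_self (j.1, j.2.1) s, fun l => ?_⟩
    rw [facePoint_apply_succAbove (j.1, j.2.1)]
    exact hs l

variable {Φ : EuclideanSpace ℝ (Fin 3) → EuclideanSpace ℝ (Fin 3)}

lemma IsBiLipschitz.image_frontier_unitCube (hΦ : IsBiLipschitz Φ)
    (hcube : Φ '' unitCube = closedBall 0 1) : Φ '' frontier unitCube = sphere 0 1 := by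
  rw [hΦ.isHomeomorph.image_frontier, hcube, frontier_closedBall _ one_ne_zero]

lemma IsBiLipschitz.exists_isBiLipschitzAtlas_sphere (hΦ : IsBiLipschitz Φ)
    (hcube : Φ '' unitCube = closedBall 0 1) :
    ∃ χ : Fin 3 × Fin 2 → UnitBox (Fin 2) → UnitSphere, IsBiLipschitzAtlas univ χ ∧
      ∀ k j, sphereDyadicSquare Φ k j = χ (j.1, j.2.1) '' unitDyadicCube k j.2.2 := by
  obtain ⟨L, hL⟩ := hΦ.exists_lipschitzWith
  obtain ⟨a, ha⟩ := hΦ.exists_antilipschitzWith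
  have hatlas := isBiLipschitzAtlas_facePoint.comp hL ha
  rw [hΦ.image_frontier_unitCube hcube] at hatlas
  obtain ⟨χ, hχ, hatlas'⟩ := hatlas.exists_subtype
  refine ⟨χ, hatlas', fun k j => ?_⟩
  rw [sphereDyadicSquare, cubeDyadicSquare_eq_image, ← image_comp, ← hχ, image_comp,
    preimage_image_eq _ Subtype.val_injective]

theorem IsBiLipschitz.gagliardoEnergy_sphere_iff (hΦ : IsBiLipschitz Φ)
    (hcube : Φ '' unitCube = closedBall 0 1) {q : ℝ} (hq : 2 < q) (φ : UnitSphere ≃ₜ UnitSphere) :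
    gagliardoEnergy (μH[2] : Measure UnitSphere) q φ < ⊤ ↔
      diameterSum (sphereDyadicSquare Φ) q φ < ⊤ := by
  obtain ⟨χ, hχ, hsq⟩ := hΦ.exists_isBiLipschitzAtlas_sphere hcube
  have hQ : IsDyadicCovering univ (sphereDyadicSquare Φ) := by
    convert (hχ.isDyadicCovering isDyadicCovering_unitDyadicCube).comp_equiv
      fun k => (Equiv.prodAssoc _ _ _).symm using 3 with k j
    exact hsq k j
  have hμ : IsAhlforsRegular (μH[2] : Measure UnitSphere) 2 :=
    hχ.isAhlforsRegular zero_le_two (by simpa using isAhlforsRegular_unitBox (Fin 2))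
  have := hμ.isFiniteMeasure zero_le_two
  have hE : 1 < Module.rank ℝ (EuclideanSpace ℝ (Fin 3)) := by
    simp [← Module.finrank_eq_rank]
  refine ⟨fun h => ?_, fun h => ?_⟩
  · obtain ⟨c, hc, hlow⟩ := hμ.exists_le_measure_closedBall
    refine diameterSum_lt_top_of_gagliardoEnergy_lt_top isCompact_univ hQ hc one_pos
      (fun _ _ y _ s hs => ?_) one_pos (fun _ => ediam_le_ediam_frontier_of_sphere hE) hq φ h
    rcases lt_or_ge s 0 with hs0 | hs0
    · simp [ENNReal.ofReal_of_nonpos hs0.le]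
    · exact_mod_cast hlow y s ⟨hs0, hs⟩
  · obtain ⟨C, hC, hup⟩ := hμ.exists_measure_closedBall_le
    refine gagliardoEnergy_lt_top_of_diameterSum_lt_top (Filter.Eventually.of_forall mem_univ) hC
      (fun x r => by exact_mod_cast hup x r) hQ (fun x _ y _ => ?_) (by linarith) φ.continuous
      (isCompact_univ.image φ.continuous).isBounded.ediam_ne_top h
    rw [univ_inter]
    exact exists_isPreconnected_subset_closedBall_of_sphere hE x y

end Sphere

/-- The surface measure of the sphere is the two-dimensional Hausdorff measure `μH[2]`
(up to a constant factor, which does not affect finiteness). -/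
theorem theorem1p1 (q : ℝ) (hq : 2 < q) :
    (∀ Φ : EuclideanSpace ℝ (Fin 3) → EuclideanSpace ℝ (Fin 3),
      IsBiLipschitz Φ → Φ '' unitCube = Metric.closedBall 0 1 →
      ∀ φ : UnitSphere ≃ₜ UnitSphere,
        gagliardoEnergy (Measure.hausdorffMeasure 2 : Measure UnitSphere) q φ < ⊤ ↔
          diameterSum (sphereDyadicSquare Φ) q φ < ⊤) ∧
    (∀ φ : EuclideanSpace ℝ (Fin 2) ≃ₜ EuclideanSpace ℝ (Fin 2),
      (∀ R : ℝ, 0 < R → gagliardoEnergy (volume.restrict (planeSquare R)) q φ < ⊤) ↔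
        ∀ N : ℕ, 1 ≤ N → diameterSum (planeDyadicSquare (N : ℝ)) q φ < ⊤) :=
  ⟨fun _ hΦ hcube φ => hΦ.gagliardoEnergy_sphere_iff hcube hq φ,
    fun φ => gagliardoEnergy_plane_iff hq φ⟩
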